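/- Let $E$ be a Euclidean space (a finite-dimensional real inner product space), let $X^{*}$ denote the adjoint of $X\in\mathfrak{gl}(E)$, and let $(X,Y)=\mathrm{tr}(XY)$ be the trace form. Let $\mathfrak g\subset\mathfrak{gl}(E)$ be a real reductive Lie algebra with Cartan involution, i.e. a Lie subalgebra invariant under $\theta(X)=-X^{*}$, with Cartan decomposition $\mathfrak g=\mathfrak k\oplus\mathfrak s$ into skew symmetric and symmetric operators, and assume that the connected Lie subgroup $K<\mathrm{SO}(E)$ with Lie algebra $\mathfrak k$ is compact. Let $G<\mathrm{GL}(E)$ be the connected Lie subgroup with Lie algebra $\mathfrak g$, and $dk$ the normalized Haar measure on $K$. Fix a maximal commutative linear subspace $\mathfrak a\subset\mathfrak s$, with complexification $\mathfrak a_c$, and a Weyl chamber in $\mathfrak a$. Let $\mathfrak n$ be the sum of the root spaces $\mathfrak g_\alpha=\{X\in\mathfrak g : [H,X]=\alpha(H)X \text{ for all } H\in\mathfrak a\}$ over the positive restricted roots $\alpha$ (those positive on the open chamber), let $\rho=\tfrac12\sum_{\alpha>0}\dim(\mathfrak g_\alpha)\,\alpha$, and let $A=\exp\mathfrak a$ and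 $N$ be the connected Lie subgroups with Lie algebras $\mathfrak a$ and $\mathfrak n$. Let $G=KAN$ be the Iwasawa decomposition, and for $g\in G$ let $A(g)\in\mathfrak a$ be the Iwasawa projection, i.e. the unique $H\in\mathfrak a$ with $g\in K\exp(H)N$. Identify $\mathfrak a$ with its dual by the trace form, and extend $(\cdot,\cdot)$ complex linearly to $\mathfrak a_c$ in the first argument. For $\lambda\in\mathfrak a_c$ let \[ \phi_\lambda(g)=\int_K e^{(\lambda-\rho,\,A(gk))}\,dk\quad(g\in G),\qquad \psi_\lambda(X)=\int_K e^{(\lambda,\,kXk^{*})}\,dk\quad(X\in\mathfrak s) \] be the Harish-Chandra elementary spherical function and the symmetrized plane wave. Then \[ \psi_\lambda(X)=\lim_{n\to\infty}\phi_{n\lambda}(\exp(X/n)) \] for all $\lambda\in\mathfrak a_c$ and $X\in\mathfrak s$. -/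

import Mathlib

open Filter Topology MeasureTheory
open scoped TensorProduct

attribute [local instance] LieRing.ofAssociativeRing

/-! Throughout, `E` is a Euclidean space, i.e. a finite dimensional real inner product space
(the instance `CompleteSpace E` is then automatic), `𝔤𝔩(E)` is the Lie algebra
`E →L[ℝ] E` with the commutator bracket, `X* = star X` is the adjoint of `X`, and `GL(E)` is the
group of units of `E →L[ℝ] E`. -/

namespace RealReductive

noncomputable section

variable {E : Type*} [NormedAddCommGroup E] [InnerProductSpace ℝ E] [FiniteDimensional ℝ E]
  [CompleteSpace E]

/-- The trace form `(X, Y) = tr (X Y)` on `𝔤𝔩(E)`. -/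
def traceForm : (E →L[ℝ] E) →ₗ[ℝ] (E →L[ℝ] E) →ₗ[ℝ] ℝ :=
  (LinearMap.mul ℝ (E →L[ℝ] E)).compr₂ (LinearMap.trace ℝ E ∘ₗ ContinuousLinearMap.coeLM ℝ)

/-- The exponential map `𝔤𝔩(E) → GL(E)`. -/
def expGL (X : E →L[ℝ] E) : (E →L[ℝ] E)ˣ where
  val := NormedSpace.exp X
  inv := NormedSpace.exp (-X)
  val_inv := by
    let _ : NormedAlgebra ℚ (E →L[ℝ] E) := NormedAlgebra.restrictScalars ℚ ℝ (E →L[ℝ] E)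
    rw [← NormedSpace.exp_add_of_commute (Commute.refl X).neg_right, add_neg_cancel,
      NormedSpace.exp_zero]
  inv_val := by
    let _ : NormedAlgebra ℚ (E →L[ℝ] E) := NormedAlgebra.restrictScalars ℚ ℝ (E →L[ℝ] E)
    rw [← NormedSpace.exp_add_of_commute (Commute.refl X).neg_left, neg_add_cancel,
      NormedSpace.exp_zero]

/-- The connected Lie subgroup of `GL(E)` with Lie algebra `𝔥`: the subgroup generated by
`exp 𝔥`. (It is only used when `𝔥` is closed under the bracket.) -/
def lieSubgroup (𝔥 : Submodule ℝ (E →L[ℝ] E)) : Subgroup (E →L[ℝ] E)ˣ :=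
  Subgroup.closure (expGL '' (𝔥 : Set (E →L[ℝ] E)))

/-- The `+1` eigenspace `𝔨 = {X ∈ 𝔤 | θ X = X}` of the Cartan involution `θ X = -X*`, i.e. the
space of skew symmetric elements of `𝔤`. -/
def skewPart (𝔤 : LieSubalgebra ℝ (E →L[ℝ] E)) : Submodule ℝ (E →L[ℝ] E) where
  carrier := {X | X ∈ 𝔤 ∧ -star X = X}
  zero_mem' := by simp
  add_mem' := by
    rintro X Y ⟨hX, hX'⟩ ⟨hY, hY'⟩
    exact ⟨add_mem hX hY, by rw [star_add, neg_add, hX', hY']⟩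
  smul_mem' := by
    rintro c X ⟨hX, hX'⟩
    exact ⟨𝔤.smul_mem c hX, by rw [star_smul, star_trivial, ← smul_neg, hX']⟩

/-- The `-1` eigenspace `𝔰 = {X ∈ 𝔤 | θ X = -X}` of the Cartan involution `θ X = -X*`, i.e. the
space of symmetric elements of `𝔤`. -/
def symmPart (𝔤 : LieSubalgebra ℝ (E →L[ℝ] E)) : Submodule ℝ (E →L[ℝ] E) where
  carrier := {X | X ∈ 𝔤 ∧ -star X = -X}
  zero_mem' := by simp
  add_mem' := by
    rintro X Y ⟨hX, hX'⟩ ⟨hY, hY'⟩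
    exact ⟨add_mem hX hY, by rw [star_add, neg_add, hX', hY', neg_add]⟩
  smul_mem' := by
    rintro c X ⟨hX, hX'⟩
    exact ⟨𝔤.smul_mem c hX, by rw [star_smul, star_trivial, ← smul_neg, hX', smul_neg]⟩

instance : BorelSpace (E →L[ℝ] E)ˣ where
  measurable_eq := by
    have h : (inferInstance : TopologicalSpace (E →L[ℝ] E)ˣ)
        = TopologicalSpace.induced Units.val inferInstance :=
      (Units.isOpenEmbedding_val (R := E →L[ℝ] E)).isInducing.eq_induced
    calc (Units.instMeasurableSpace : MeasurableSpace (E →L[ℝ] E)ˣ)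
        = MeasurableSpace.comap Units.val (borel (E →L[ℝ] E)) :=
          congrArg _ BorelSpace.measurable_eq
      _ = @borel _ (TopologicalSpace.induced Units.val inferInstance) := borel_comap.symm
      _ = borel (E →L[ℝ] E)ˣ := congrArg _ h.symm

variable (E) in
/-- A real reductive Lie algebra with Cartan involution: a Lie subalgebra `𝔤` of `𝔤𝔩(E)` that is
invariant under `θ X = -X*`, such that the connected Lie subgroup `K` of `GL(E)` with Lie algebra
`𝔨` is compact. -/
structure ReductiveLieAlgebra where
  /-- the Lie algebra `𝔤` -/
  toLieSubalgebra : LieSubalgebra ℝ (E →L[ℝ] E)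
  cartan_mem : ∀ X ∈ toLieSubalgebra, -star X ∈ toLieSubalgebra
  isCompact_lieSubgroup :
    IsCompact (lieSubgroup (skewPart toLieSubalgebra) : Set (E →L[ℝ] E)ˣ)

namespace ReductiveLieAlgebra

variable (𝔤 : ReductiveLieAlgebra E)

/-- The space `𝔰` of the Cartan decomposition `𝔤 = 𝔨 ⊕ 𝔰`. -/
abbrev 𝔰 : Submodule ℝ (E →L[ℝ] E) := symmPart 𝔤.toLieSubalgebra

/-- The connected Lie subgroup `G` of `GL(E)` with Lie algebra `𝔤`. -/
abbrev G : Subgroup (E →L[ℝ] E)ˣ := lieSubgroup 𝔤.toLieSubalgebra.toSubmodule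

/-- The connected Lie subgroup `K` of `GL(E)` with Lie algebra `𝔨`. -/
abbrev K : Subgroup (E →L[ℝ] E)ˣ := lieSubgroup (skewPart 𝔤.toLieSubalgebra)

/-- The exponential map `𝔰 → G`. -/
def expG (X : 𝔤.𝔰) : 𝔤.G :=
  ⟨expGL X, Subgroup.subset_closure ⟨X, X.2.1, rfl⟩⟩

instance : CompactSpace 𝔤.K := isCompact_iff_compactSpace.mp 𝔤.isCompact_lieSubgroup

/-- The normalized Haar measure `dk` on the compact group `K`. -/
def haarK : Measure 𝔤.K := Measure.haarMeasure ⊤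

/-- `𝔞` is a maximal commutative linear subspace of `𝔰`. -/
def IsMaximalCommutative (𝔞 : Submodule ℝ (E →L[ℝ] E)) : Prop :=
  Maximal (fun 𝔟 : Submodule ℝ (E →L[ℝ] E) => 𝔟 ≤ 𝔤.𝔰 ∧ ∀ X ∈ 𝔟, ∀ Y ∈ 𝔟, ⁅X, Y⁆ = 0) 𝔞

variable (𝔞 : Submodule ℝ (E →L[ℝ] E))

/-- The simultaneous eigenspace `𝔤_α = {X ∈ 𝔤 | [H, X] = α(H) X for all H ∈ 𝔞}`. -/
def rootSpace (α : Module.Dual ℝ 𝔞) : Submodule ℝ (E →L[ℝ] E) where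
  carrier := {X | X ∈ 𝔤.toLieSubalgebra ∧ ∀ H : 𝔞, ⁅(H : E →L[ℝ] E), X⁆ = α H • X}
  zero_mem' := by simp
  add_mem' := by
    rintro X Y ⟨hX, hX'⟩ ⟨hY, hY'⟩
    exact ⟨add_mem hX hY, fun H => by rw [lie_add, hX', hY', smul_add]⟩
  smul_mem' := by
    rintro c X ⟨hX, hX'⟩
    exact ⟨𝔤.toLieSubalgebra.smul_mem c hX, fun H => by rw [lie_smul, hX', smul_comm]⟩

/-- The set of restricted roots of `𝔞` in `𝔤`. -/
def roots : Set (Module.Dual ℝ 𝔞) := {α | α ≠ 0 ∧ 𝔤.rootSpace 𝔞 α ≠ ⊥}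

lemma finite_roots : (𝔤.roots 𝔞).Finite := by
  classical
  let b := Module.finBasis ℝ 𝔞
  let ad : 𝔞 → Module.End ℝ (E →L[ℝ] E) := fun H =>
    LinearMap.mulLeft ℝ (H : E →L[ℝ] E) - LinearMap.mulRight ℝ (H : E →L[ℝ] E)
  have hfin : (Set.univ.pi fun i => {c : ℝ | (ad (b i)).HasEigenvalue c}).Finite :=
    Set.Finite.pi fun i => Module.End.finite_hasEigenvalue (ad (b i))
  refine Set.Finite.of_finite_image (f := fun α i => α (b i)) (hfin.subset ?_) ?_
  · rintro _ ⟨α, ⟨-, hα⟩, rfl⟩ i -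
    obtain ⟨X, hX, hX0⟩ := Submodule.exists_mem_ne_zero_of_ne_bot hα
    exact Module.End.hasEigenvalue_of_hasEigenvector
      ⟨Module.End.mem_eigenspace_iff.mpr (hX.2 (b i)), hX0⟩
  · intro α _ β _ h
    exact b.ext fun i => congrFun h i

/-- `H₀ ∈ 𝔞` is regular: it lies on none of the mirrors `α = 0`, so that it lies in the interior
of a unique closed Weyl chamber `𝔞₊`. -/
def IsRegular (H₀ : 𝔞) : Prop := ∀ α ∈ 𝔤.roots 𝔞, α H₀ ≠ 0

/-- The positive restricted roots for the Weyl chamber of the regular element `H₀`: those that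
are positive at `H₀`, equivalently on the open chamber containing `H₀`. -/
def posRoots (H₀ : 𝔞) : Set (Module.Dual ℝ 𝔞) := {α | α ∈ 𝔤.roots 𝔞 ∧ 0 < α H₀}

/-- `𝔫`, the sum of the root spaces of the positive restricted roots. -/
def nilpotentPart (H₀ : 𝔞) : Submodule ℝ (E →L[ℝ] E) :=
  ⨆ α ∈ 𝔤.posRoots 𝔞 H₀, 𝔤.rootSpace 𝔞 α

/-- The connected Lie subgroup `N` of `GL(E)` with Lie algebra `𝔫`. -/
abbrev N (H₀ : 𝔞) : Subgroup (E →L[ℝ] E)ˣ := lieSubgroup (𝔤.nilpotentPart 𝔞 H₀)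

/-- The restricted Weyl vector `ρ`, half the sum of the positive restricted roots counted with
multiplicities, as a linear form on `𝔞`. (The set of restricted roots is finite, see
`finite_roots`.) -/
def rho (H₀ : 𝔞) : Module.Dual ℝ 𝔞 :=
  (1 / 2 : ℝ) • ∑ᶠ α ∈ 𝔤.posRoots 𝔞 H₀, Module.finrank ℝ (𝔤.rootSpace 𝔞 α) • α

open Classical in
/-- The Iwasawa projection `A`: for `g ∈ G = K A N` (where the group `A` is `exp 𝔞`), it is the
unique `H ∈ 𝔞` with `g ∈ K exp(H) N`. (Outside of `K A N` it takes the value `0`.) -/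
def iwasawaProj (H₀ : 𝔞) (g : (E →L[ℝ] E)ˣ) : 𝔞 :=
  if h : ∃ H : 𝔞, ∃ k ∈ 𝔤.K, ∃ n ∈ 𝔤.N 𝔞 H₀, g = k * expGL (H : E →L[ℝ] E) * n
  then h.choose else 0

/-- The trace form, extended complex linearly in its first argument to a pairing `(λ, Y)` of
`λ` in the complexification `𝔞_c = ℂ ⊗ 𝔞` with `Y ∈ 𝔤𝔩(E)`. -/
def pairing (lam : ℂ ⊗[ℝ] 𝔞) (Y : E →L[ℝ] E) : ℂ :=
  LinearMap.liftBaseChange ℂ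
    (Complex.ofRealCLM.toLinearMap ∘ₗ traceForm.flip Y ∘ₗ 𝔞.subtype) lam

/-- The elementary spherical function of Harish-Chandra,
`φ_λ(g) = ∫_K exp((λ - ρ)(A(g k))) dk`, where `λ ∈ 𝔞_c` is regarded as a linear form on `𝔞` by
means of the trace form. -/
def sphericalFunction (H₀ : 𝔞) (lam : ℂ ⊗[ℝ] 𝔞) (g : 𝔤.G) : ℂ :=
  ∫ k : 𝔤.K, Complex.exp
    (pairing 𝔞 lam (𝔤.iwasawaProj 𝔞 H₀ ((g : (E →L[ℝ] E)ˣ) * (k : (E →L[ℝ] E)ˣ)))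
      - (𝔤.rho 𝔞 H₀ (𝔤.iwasawaProj 𝔞 H₀ ((g : (E →L[ℝ] E)ˣ) * (k : (E →L[ℝ] E)ˣ))) : ℂ))
    ∂𝔤.haarK

/-- The symmetrized plane wave `ψ_λ(X) = ∫_K exp((λ, k X k*)) dk`. -/
def planeWave (lam : ℂ ⊗[ℝ] 𝔞) (X : 𝔤.𝔰) : ℂ :=
  ∫ k : 𝔤.K, Complex.exp
    (pairing 𝔞 lam (((k : (E →L[ℝ] E)ˣ) : E →L[ℝ] E) * (X : E →L[ℝ] E)
      * star ((k : (E →L[ℝ] E)ˣ) : E →L[ℝ] E))) ∂𝔤.haarK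

end ReductiveLieAlgebra

end

end RealReductive

/-! For `k ∈ K` one has `exp(X/n) k = k exp(k*Xk/n)`, so the Iwasawa projection of `exp(X/n) k` is
that of `exp(k*Xk/n)`. To first order it is `P(k*Xk)/n`, where `P` is an `𝔞`-component for `𝔤 = 𝔨 +
𝔞 + 𝔫`. After multiplication by `nλ - ρ` the `λ`-part tends to `(λ, P(k*Xk))` and the `ρ`-part to
zero. As `𝔞` is orthogonal to `𝔨` and `𝔫` for the trace form, `(λ, P(k*Xk)) = (λ, k*Xk)`. Dominated
convergence and the substitution `k ↦ k⁻¹` turn the limit into the plane wave.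

The first order behaviour comes from a local Iwasawa decomposition built by differential equations
(`exists_iwasawaProj_eq_integral`). With `p` a `𝔨`-component, solve `q' = q p(y)`, `y = q*Yq`, `q(0)
= 1`. Then `b = q* exp(tY)` satisfies `b' = (y - p(y)) b` with coefficient in `𝔞 + 𝔫`. Putting `H =
∫ P(y)`, the curve `exp(-H) b` has its coefficient in `𝔫`, so `exp(tY) = q exp(H) n` and the
projection is `H(t)`.

Since `K` and `N` are the abstract groups generated by exponentials, membership needs arguments: for
`N` induction along the nilpotent algebra (`exists_mem_lieSubgroup_of_hasDerivAt`), for `K`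
compactness and a Gronwall estimate of the distance to `K` (`mem_of_hasDerivAt_of_skew`). That the
projection is well defined is proved by comparing traces (`iwasawa_unique`). -/

set_option linter.unusedSectionVars false

/-! ### Exponentials, conjugation and linear differential equations in a Banach algebra. -/

section NormedAlgebra

variable {𝔸 : Type*} [NormedRing 𝔸] [NormedAlgebra ℝ 𝔸] [CompleteSpace 𝔸]

theorem exp_mul_exp_neg' (x : 𝔸) : NormedSpace.exp x * NormedSpace.exp (-x) = 1 := by
  let _ : NormedAlgebra ℚ 𝔸 := NormedAlgebra.restrictScalars ℚ ℝ 𝔸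
  rw [← NormedSpace.exp_add_of_commute (Commute.refl x).neg_right, add_neg_cancel,
    NormedSpace.exp_zero]

theorem exp_neg_mul_exp' (x : 𝔸) : NormedSpace.exp (-x) * NormedSpace.exp x = 1 := by
  simpa using exp_mul_exp_neg' (-x)

theorem exp_add_of_commute' {x y : 𝔸} (h : Commute x y) :
    NormedSpace.exp (x + y) = NormedSpace.exp x * NormedSpace.exp y := by
  let _ : NormedAlgebra ℚ 𝔸 := NormedAlgebra.restrictScalars ℚ ℝ 𝔸
  exact NormedSpace.exp_add_of_commute h

theorem continuous_exp' : Continuous (NormedSpace.exp : 𝔸 → 𝔸) := by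
  let _ : NormedAlgebra ℚ 𝔸 := NormedAlgebra.restrictScalars ℚ ℝ 𝔸
  exact NormedSpace.exp_continuous

/-- The exponential of left multiplication is left multiplication by the exponential. -/
theorem exp_mulLeft_apply (T X : 𝔸) :
    NormedSpace.exp (ContinuousLinearMap.mul ℝ 𝔸 T) X = NormedSpace.exp T * X := by
  have h1 := (NormedSpace.exp_series_hasSum_exp' (𝕂 := ℝ) (ContinuousLinearMap.mul ℝ 𝔸 T)).mapL
    (ContinuousLinearMap.apply ℝ 𝔸 X)
  have h2 := (NormedSpace.exp_series_hasSum_exp' (𝕂 := ℝ) T).mul_right X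
  refine h1.unique (h2.congr_fun ?_)
  intro n
  have : ∀ n : ℕ, ((ContinuousLinearMap.mul ℝ 𝔸 T) ^ n) X = T ^ n * X := by
    intro n
    induction n with
    | zero => simp
    | succ n ih => rw [pow_succ', mul_apply_eq_comp, ih]; simp [pow_succ', mul_assoc]
  simp [this]

/-- The exponential of right multiplication is right multiplication by the exponential. -/
theorem exp_mulRight_apply (T X : 𝔸) :
    NormedSpace.exp ((ContinuousLinearMap.mul ℝ 𝔸).flip T) X = X * NormedSpace.exp T := by
  have h1 := (NormedSpace.exp_series_hasSum_exp' (𝕂 := ℝ)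
    ((ContinuousLinearMap.mul ℝ 𝔸).flip T)).mapL (ContinuousLinearMap.apply ℝ 𝔸 X)
  have h2 := (NormedSpace.exp_series_hasSum_exp' (𝕂 := ℝ) T).mul_left X
  refine h1.unique (h2.congr_fun ?_)
  intro n
  have : ∀ n : ℕ, (((ContinuousLinearMap.mul ℝ 𝔸).flip T) ^ n) X = X * T ^ n := by
    intro n
    induction n with
    | zero => simp
    | succ n ih => rw [pow_succ', mul_apply_eq_comp, ih]; simp [pow_succ, mul_assoc]
  simp [this]

/-- A closed subspace that is invariant under an operator is invariant under its exponential. -/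
theorem exp_apply_mem {F : Type*} [NormedAddCommGroup F] [NormedSpace ℝ F] [CompleteSpace F]
    {W : Submodule ℝ F} (hW : IsClosed (W : Set F)) {D : F →L[ℝ] F} (hD : ∀ X ∈ W, D X ∈ W)
    {X : F} (hX : X ∈ W) : NormedSpace.exp D X ∈ W := by
  have h1 := (NormedSpace.exp_series_hasSum_exp' (𝕂 := ℝ) D).mapL
    (ContinuousLinearMap.apply ℝ F X)
  refine hW.mem_of_tendsto h1 (Eventually.of_forall fun s => W.sum_mem fun n _ => ?_)
  have : ∀ n : ℕ, (D ^ n) X ∈ W := by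
    intro n
    induction n with
    | zero => simpa
    | succ n ih => rw [pow_succ']; exact hD _ ih
  simpa using W.smul_mem _ (this n)

/-- A closed subspace that is normalized by `T` is invariant under conjugation by `exp T`. -/
theorem exp_conj_mem {W : Submodule ℝ 𝔸} (hW : IsClosed (W : Set 𝔸)) {T : 𝔸}
    (hT : ∀ X ∈ W, T * X - X * T ∈ W) {X : 𝔸} (hX : X ∈ W) :
    NormedSpace.exp T * X * NormedSpace.exp (-T) ∈ W := by
  -- `D` is `ad T`, a sum of two commuting operators: left multiplication by `T` and right
  -- multiplication by `-T`. Hence `exp D` is conjugation by `exp T`.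
  have h := exp_apply_mem hW (D := ContinuousLinearMap.mul ℝ 𝔸 T
    + (ContinuousLinearMap.mul ℝ 𝔸).flip (-T)) (fun X hX => by
      simpa [sub_eq_add_neg] using hT X hX) hX
  rw [exp_add_of_commute', mul_apply_eq_comp, exp_mulRight_apply,
    exp_mulLeft_apply, ← mul_assoc] at h
  · exact h
  · ext Y
    simp [mul_assoc]

/-- The derivative of the exponential along a curve of commuting elements. -/
theorem hasDerivAt_exp_of_commute {H : ℝ → 𝔸} {H' : 𝔸} {t : ℝ} (hH : HasDerivAt H H' t)
    (hc : ∀ s, Commute (H t) (H s)) :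
    HasDerivAt (fun s => NormedSpace.exp (H s)) (NormedSpace.exp (H t) * H') t := by
  -- By commutativity `exp(H s) = exp(H t) exp(H s - H t)`, so only the derivative of `exp` at zero
  -- is needed.
  have h0 : HasFDerivAt (NormedSpace.exp : 𝔸 → 𝔸) (1 : 𝔸 →L[ℝ] 𝔸) (H t - H t) := by
    rw [sub_self]; exact hasFDerivAt_exp_zero
  have h1 : HasDerivAt (fun s => H s - H t) H' t := hH.sub_const _
  have h2 := (h0.comp_hasDerivAt t h1).const_mul (NormedSpace.exp (H t))
  refine (h2.congr_deriv (by simp)).congr_of_eventuallyEq (Eventually.of_forall fun s => ?_)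
  simp only [Function.comp]
  rw [← exp_add_of_commute' ((hc s).sub_right (Commute.refl _)), add_sub_cancel]

/-- Splitting off a commuting factor from the solution of a linear differential equation. -/
theorem hasDerivAt_exp_neg_mul {H : ℝ → 𝔸} {c ν : 𝔸} {p : ℝ → 𝔸} {t : ℝ}
    (hH : HasDerivAt H c t) (hc : ∀ s, Commute (H t) (H s)) (hp : HasDerivAt p (ν * p t) t) :
    HasDerivAt (fun s => NormedSpace.exp (-H s) * p s)
      ((NormedSpace.exp (-H t) * (ν - c) * NormedSpace.exp (H t))
        * (NormedSpace.exp (-H t) * p t)) t := by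
  have h1 := hasDerivAt_exp_of_commute hH.neg (fun s => ((hc s).neg_left).neg_right)
  refine (h1.mul hp).congr_deriv ?_
  have h2 := exp_mul_exp_neg' (H t)
  calc _ = NormedSpace.exp (-H t) * (ν - c) * 1 * p t := by simp only [Pi.neg_apply]; noncomm_ring
    _ = _ := by rw [← h2]; simp only [mul_assoc]

/-- A continuous function on an interval has a primitive. -/
theorem exists_primitive {F : Type*} [NormedAddCommGroup F] [NormedSpace ℝ F] [CompleteSpace F]
    {ε : ℝ} {c : ℝ → F} (hc : ContinuousOn c (Set.Ioo (-ε) ε)) {t : ℝ}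
    (ht : t ∈ Set.Ioo (-ε) ε) :
    HasDerivAt (fun t => ∫ s in (0 : ℝ)..t, c s) (c t) t := by
  have h0 : (0 : ℝ) ∈ Set.Ioo (-ε) ε := by
    have := ht.1.trans ht.2
    constructor <;> linarith
  have ho := isOpen_Ioo.mem_nhds ht
  refine intervalIntegral.integral_hasDerivAt_right ?_ ?_ (hc.continuousAt ho)
  · exact (hc.mono (Set.OrdConnected.uIcc_subset Set.ordConnected_Ioo h0 ht)).intervalIntegrable
  · exact hc.stronglyMeasurableAtFilter isOpen_Ioo t ht

end NormedAlgebra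

/-! ### Integral curves that stay in groups generated by exponentials. -/

namespace RealReductive

section

variable {E : Type*} [NormedAddCommGroup E] [InnerProductSpace ℝ E] [FiniteDimensional ℝ E]
  [CompleteSpace E]

theorem isClosed_submodule (W : Submodule ℝ (E →L[ℝ] E)) : IsClosed (W : Set (E →L[ℝ] E)) :=
  W.closed_of_finiteDimensional

theorem expGL_mem_lieSubgroup {𝔥 : Submodule ℝ (E →L[ℝ] E)} {X : E →L[ℝ] E} (hX : X ∈ 𝔥) :
    expGL X ∈ lieSubgroup 𝔥 :=
  Subgroup.subset_closure ⟨X, hX, rfl⟩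

/-- Integral curves of a time dependent invariant vector field with values in a nilpotent Lie
algebra stay in the subgroup generated by its exponentials. -/
theorem exists_mem_lieSubgroup_of_hasDerivAt {𝔫 : Submodule ℝ (E →L[ℝ] E)}
    (hnil : ∀ 𝔪 ≤ 𝔫, 𝔪 ≤ Submodule.span ℝ {Z | ∃ X ∈ 𝔫, ∃ Y ∈ 𝔪, Z = X * Y - Y * X} → 𝔪 = ⊥)
    {ε : ℝ} (𝔪 : Submodule ℝ (E →L[ℝ] E)) (h𝔪 : 𝔪 ≤ 𝔫)
    (hbr : ∀ X ∈ 𝔫, ∀ Y ∈ 𝔪, X * Y - Y * X ∈ 𝔪) {ν p : ℝ → E →L[ℝ] E}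
    (hν : ContinuousOn ν (Set.Ioo (-ε) ε)) (hν𝔪 : ∀ t ∈ Set.Ioo (-ε) ε, ν t ∈ 𝔪)
    (hp0 : p 0 = 1) (hp : ∀ t ∈ Set.Ioo (-ε) ε, HasDerivAt p (ν t * p t) t)
    {t : ℝ} (ht : t ∈ Set.Ioo (-ε) ε) :
    ∃ g ∈ lieSubgroup 𝔫, (g : E →L[ℝ] E) = p t := by
  -- Induction on the dimension of the ideal `𝔪` of `𝔫` that contains the coefficient `ν`. If it is
  -- zero, the curve is constant.
  induction hd : Module.finrank ℝ 𝔪 using Nat.strong_induction_on generalizing 𝔪 ν p t with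
  | _ d ih =>
  have h0 : (0 : ℝ) ∈ Set.Ioo (-ε) ε := by
    have := ht.1.trans ht.2
    constructor <;> linarith
  by_cases hbot : 𝔪 = ⊥
  · refine ⟨1, one_mem _, ?_⟩
    have hp' : ∀ s ∈ Set.Ioo (-ε) ε, HasDerivAt p 0 s := fun s hs => by
      have h1 := hν𝔪 s hs
      rw [hbot, Submodule.mem_bot] at h1
      simpa [h1] using hp s hs
    have := isOpen_Ioo.is_const_of_deriv_eq_zero isPreconnected_Ioo
      (fun s hs => (hp' s hs).differentiableAt.differentiableWithinAt)
      (fun s hs => (hp' s hs).deriv) h0 ht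
    rw [← this, hp0]; rfl
  set 𝔡 := Submodule.span ℝ {Z | ∃ X ∈ 𝔫, ∃ Y ∈ 𝔪, Z = X * Y - Y * X} with h𝔡
  -- By nilpotency `[𝔫, 𝔪]` does not contain `𝔪`. A functional that kills `[𝔫, 𝔪]` but not `x` cuts
  -- out of `𝔪` a smaller ideal of `𝔫`.
  obtain ⟨x, hx𝔪, hx𝔡⟩ : ∃ x ∈ 𝔪, x ∉ 𝔡 := by
    by_contra! h
    exact hbot (hnil 𝔪 h𝔪 h)
  obtain ⟨f, hfx, hf⟩ := Submodule.exists_le_ker_of_notMem hx𝔡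
  obtain ⟨f, hfx, hf⟩ : ∃ f : (E →L[ℝ] E) →ₗ[ℝ] ℝ, f x = 1 ∧ 𝔡 ≤ LinearMap.ker f :=
    ⟨(f x)⁻¹ • f, by simp [hfx], fun y hy => by
      have := hf hy
      rw [LinearMap.mem_ker] at this ⊢
      simp [this]⟩
  set 𝔪' := 𝔪 ⊓ LinearMap.ker f with h𝔪'
  have hbr' : ∀ X ∈ 𝔫, ∀ Y ∈ 𝔪', X * Y - Y * X ∈ 𝔪' := fun X hX Y hY =>
    ⟨hbr X hX Y hY.1, hf (Submodule.subset_span ⟨X, hX, Y, hY.1, rfl⟩)⟩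
  have hlt : Module.finrank ℝ 𝔪' < d := by
    rw [← hd]
    refine Submodule.finrank_lt_finrank_of_lt (lt_of_le_of_ne inf_le_left fun h => ?_)
    have : x ∈ 𝔪' := h ▸ hx𝔪
    exact one_ne_zero (hfx.symm.trans this.2)
  have hfc : Continuous f := f.continuous_of_finiteDimensional
  have hcf : ContinuousOn (fun t => f (ν t)) (Set.Ioo (-ε) ε) := hfc.comp_continuousOn hν
  -- Dividing the curve by `exp(H t)` removes the `x`-component of `ν`. What remains is a conjugate
  -- of `ν - f(ν) x`, which stays in `𝔪'` because `H t ∈ 𝔫` normalizes `𝔪'`.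
  set H : ℝ → E →L[ℝ] E := fun t => (∫ s in (0 : ℝ)..t, f (ν s)) • x with hH
  have hHd : ∀ t ∈ Set.Ioo (-ε) ε, HasDerivAt H (f (ν t) • x) t := fun t ht =>
    (exists_primitive hcf ht).smul_const x
  have hHcomm : ∀ s t, Commute (H s) (H t) := fun s t =>
    ((Commute.refl x).smul_left _).smul_right _
  have hH𝔪 : ∀ t, H t ∈ 𝔪 := fun t => 𝔪.smul_mem _ hx𝔪
  have hHc : ContinuousOn H (Set.Ioo (-ε) ε) := fun t ht => (hHd t ht).continuousAt.continuousWithinAt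
  obtain ⟨g, hg, hgp⟩ := ih _ hlt 𝔪' (inf_le_left.trans h𝔪) hbr'
    (ν := fun t => NormedSpace.exp (-H t) * (ν t - f (ν t) • x) * NormedSpace.exp (H t))
    (p := fun t => NormedSpace.exp (-H t) * p t)
    (((continuous_exp'.comp_continuousOn hHc.neg).mul
      (hν.sub (hcf.smul continuousOn_const))).mul (continuous_exp'.comp_continuousOn hHc))
    (fun t ht => by
      have := exp_conj_mem (isClosed_submodule 𝔪') (T := -H t)
        (hbr' _ (h𝔪 (𝔪.neg_mem (hH𝔪 t)))) (X := ν t - f (ν t) • x)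
        ⟨𝔪.sub_mem (hν𝔪 t ht) (𝔪.smul_mem _ hx𝔪), by simp [hfx]⟩
      simpa using this)
    (by simp [hH, hp0])
    (fun t ht => hasDerivAt_exp_neg_mul (hHd t ht) (hHcomm t) (hp t ht)) ht rfl
  refine ⟨expGL (H t) * g, mul_mem (expGL_mem_lieSubgroup (h𝔪 (hH𝔪 t))) hg, ?_⟩
  rw [Units.val_mul, hgp]
  change NormedSpace.exp (H t) * _ = _
  rw [← mul_assoc, exp_mul_exp_neg', one_mul]

/-- Integral curves of a time dependent invariant vector field with values in a space of skew
symmetric operators stay in every closed set that is invariant under its exponentials. -/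
theorem mem_of_hasDerivAt_of_skew {S : Set (E →L[ℝ] E)} (hS : IsClosed S) (h1 : 1 ∈ S)
    {𝔨 : Submodule ℝ (E →L[ℝ] E)} (hskew : ∀ T ∈ 𝔨, star T = -T)
    (hmul : ∀ g ∈ S, ∀ T ∈ 𝔨, g * NormedSpace.exp T ∈ S) {b : ℝ} {κ k : ℝ → E →L[ℝ] E}
    (hκ : ∀ t, κ t ∈ 𝔨) (hk0 : k 0 = 1)
    (hk : ∀ t ∈ Set.Icc 0 b, HasDerivAt k (k t * κ t) t) {t : ℝ} (ht : t ∈ Set.Icc 0 b) :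
    k t ∈ S := by
  have hne : S.Nonempty := ⟨1, h1⟩
  rw [hS.mem_iff_infDist_zero hne]
  have hcont : ContinuousOn (fun t => Metric.infDist (k t) S) (Set.Icc 0 b) := fun t ht =>
    ((Metric.continuous_infDist_pt S).continuousAt.comp
      (hk t ht).continuousAt).continuousWithinAt
  -- The distance from `k` to `S` starts at zero and has lower right derivative at most zero. Indeed
  -- `k z` agrees to first order with `k x * exp((z - x) κ x)`, and right multiplication by this
  -- orthogonal exponential preserves the norm and maps `S` into itself, so it does not increase the
  -- distance.
  have key := le_gronwallBound_of_liminf_deriv_right_le (f' := fun _ => 0) (δ := 0) (K := 0)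
    (ε := 0) hcont ?_ ?_ (by simp) t ht
  · rw [gronwallBound_ε0_δ0] at key
    exact le_antisymm key Metric.infDist_nonneg
  · intro x hx r hr
    refine Eventually.frequently ?_
    have hd : HasDerivAt (fun z => k z - k x * NormedSpace.exp ((z - x) • κ x)) 0 x := by
      have h2 : HasDerivAt (fun z : ℝ => (z - x) • κ x) (κ x) x := by
        simpa using ((hasDerivAt_id x).sub_const x).smul_const (κ x)
      have h3 := hasDerivAt_exp_of_commute h2
        (fun s => ((Commute.refl (κ x)).smul_left _).smul_right _)
      exact ((hk x ⟨hx.1, hx.2.le⟩).sub (h3.const_mul (k x))).congr_deriv (by simp)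
    have hlo := (hasDerivAt_iff_isLittleO.1 hd).bound (half_pos hr)
    filter_upwards [nhdsWithin_le_nhds hlo, self_mem_nhdsWithin] with z hz hzx
    have hzx : 0 < z - x := sub_pos.2 hzx
    simp only [sub_self, zero_smul, NormedSpace.exp_zero, mul_one, smul_zero, sub_zero,
      Real.norm_eq_abs, abs_of_pos hzx] at hz
    set U := NormedSpace.exp ((z - x) • κ x) with hU
    have hTk : (z - x) • κ x ∈ 𝔨 := 𝔨.smul_mem _ (hκ x)
    have hUu : U ∈ unitary (E →L[ℝ] E) := by
      rw [Unitary.mem_iff, hU, NormedSpace.star_exp, hskew _ hTk]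
      exact ⟨exp_neg_mul_exp' _, exp_mul_exp_neg' _⟩
    have h4 : Metric.infDist (k x * U) S ≤ Metric.infDist (k x) S := by
      refine (Metric.le_infDist hne).2 fun s hs => ?_
      refine (Metric.infDist_le_dist_of_mem (hmul s hs _ hTk)).trans_eq ?_
      rw [dist_eq_norm, dist_eq_norm, ← sub_mul, CStarRing.norm_mul_mem_unitary _ hUu]
    have h5 : Metric.infDist (k z) S ≤ Metric.infDist (k x * U) S + ‖k z - k x * U‖ := by
      rw [← dist_eq_norm]; exact Metric.infDist_le_infDist_add_dist
    rw [inv_mul_lt_iff₀ hzx]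
    nlinarith [mul_pos hr hzx]
  · rw [hk0, Metric.infDist_zero_of_mem h1]

end

end RealReductive

/-! ### Simultaneous diagonalization and exponentials on eigenvectors. -/

section Eigenvectors

/-- A commuting family of operators that are symmetric for a positive definite symmetric bilinear
form is simultaneously diagonalizable. -/
theorem iSup_iInf_eigenspace_eq_top_of_symm {V ι : Type*} [AddCommGroup V] [Module ℝ V]
    [FiniteDimensional ℝ V] (B : V →ₗ[ℝ] V →ₗ[ℝ] ℝ) (hsymm : ∀ x y, B x y = B y x)
    (hnonneg : ∀ x, 0 ≤ B x x) (hdef : ∀ x, B x x = 0 → x = 0) {T : ι → V →ₗ[ℝ] V}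
    (hT : ∀ i x y, B (T i x) y = B x (T i y)) (hcomm : ∀ i j, Commute (T i) (T j)) :
    ⨆ χ : ι → ℝ, ⨅ i, Module.End.eigenspace (T i) (χ i) = ⊤ := by
  let core : InnerProductSpace.Core ℝ V :=
    { inner := fun x y => B x y
      conj_inner_symm := fun x y => by simp [hsymm x y]
      re_inner_nonneg := fun x => by simpa using hnonneg x
      add_left := fun x y z => by simp
      smul_left := fun x y r => by simp
      definite := fun x h => hdef x h }
  let _ : NormedAddCommGroup V := core.toNormedAddCommGroup
  let _ : InnerProductSpace ℝ V := InnerProductSpace.ofCore core.toCore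
  exact LinearMap.IsSymmetric.iSup_iInf_eq_top_of_commute (𝕜 := ℝ) (T := T)
    (fun i x y => hT i x y) (fun i j _ => hcomm i j)

variable {F : Type*} [NormedAddCommGroup F] [NormedSpace ℝ F] [CompleteSpace F]

theorem exp_apply_of_apply_eq_smul {D : F →L[ℝ] F} {x : F} {c : ℝ} (h : D x = c • x) :
    NormedSpace.exp D x = Real.exp c • x := by
  have h1 := (NormedSpace.exp_series_hasSum_exp' (𝕂 := ℝ) D).mapL
    (ContinuousLinearMap.apply ℝ F x)
  have h2 := (NormedSpace.exp_series_hasSum_exp' (𝕂 := ℝ) c).smul_const x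
  rw [← Real.exp_eq_exp_ℝ] at h2
  refine h1.unique (h2.congr_fun ?_)
  intro n
  have : ∀ n : ℕ, (D ^ n) x = c ^ n • x := by
    intro n
    induction n with
    | zero => simp
    | succ n ih =>
      rw [pow_succ', mul_apply_eq_comp, ih, map_smul, h, smul_smul,
        pow_succ]
  simp [this, smul_smul]

theorem exp_conj_of_eq_smul {𝔸 : Type*} [NormedRing 𝔸] [NormedAlgebra ℝ 𝔸] [CompleteSpace 𝔸]
    {T X : 𝔸} {c : ℝ} (h : T * X - X * T = c • X) :
    NormedSpace.exp T * X * NormedSpace.exp (-T) = Real.exp c • X := by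
  have h' := exp_apply_of_apply_eq_smul (D := ContinuousLinearMap.mul ℝ 𝔸 T
    + (ContinuousLinearMap.mul ℝ 𝔸).flip (-T)) (x := X) (c := c)
    (by simpa [sub_eq_add_neg] using h)
  rw [exp_add_of_commute', mul_apply_eq_comp, exp_mulRight_apply,
    exp_mulLeft_apply, ← mul_assoc] at h'
  · exact h'
  · ext Y
    simp [mul_assoc]

end Eigenvectors

namespace RealReductive

/-! ### The trace form and its positivity. -/

section Trace

variable {E : Type*} [NormedAddCommGroup E] [InnerProductSpace ℝ E] [FiniteDimensional ℝ E]
  [CompleteSpace E]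

theorem traceForm_apply (X Y : E →L[ℝ] E) :
    traceForm X Y = LinearMap.trace ℝ E ((X * Y : E →L[ℝ] E) : E →ₗ[ℝ] E) := rfl

theorem traceForm_comm (X Y : E →L[ℝ] E) : traceForm X Y = traceForm Y X :=
  LinearMap.trace_mul_comm ℝ (X : E →ₗ[ℝ] E) (Y : E →ₗ[ℝ] E)

theorem traceForm_mul_left (X Y Z : E →L[ℝ] E) : traceForm (X * Y) Z = traceForm X (Y * Z) := by
  rw [traceForm_apply, traceForm_apply, mul_assoc]

theorem trace_eq_sum_inner_apply (X : E →L[ℝ] E) :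
    LinearMap.trace ℝ E (X : E →ₗ[ℝ] E)
      = ∑ i, inner ℝ (stdOrthonormalBasis ℝ E i) (X (stdOrthonormalBasis ℝ E i)) :=
  LinearMap.trace_eq_sum_inner _ (stdOrthonormalBasis ℝ E)

theorem trace_star (X : E →L[ℝ] E) :
    LinearMap.trace ℝ E ((star X : E →L[ℝ] E) : E →ₗ[ℝ] E)
      = LinearMap.trace ℝ E (X : E →ₗ[ℝ] E) := by
  rw [trace_eq_sum_inner_apply, trace_eq_sum_inner_apply]
  refine Finset.sum_congr rfl fun i _ => ?_
  rw [ContinuousLinearMap.star_eq_adjoint, ContinuousLinearMap.adjoint_inner_right,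
    real_inner_comm]

theorem traceForm_star_star (X Y : E →L[ℝ] E) :
    traceForm (star X) (star Y) = traceForm X Y := by
  rw [traceForm_comm X, traceForm_apply, ← star_mul, trace_star, traceForm_apply]

theorem traceForm_star_self (X : E →L[ℝ] E) :
    traceForm (star X) X = ∑ i, ‖X (stdOrthonormalBasis ℝ E i)‖ ^ 2 := by
  rw [traceForm_apply, trace_eq_sum_inner_apply]
  refine Finset.sum_congr rfl fun i _ => ?_
  rw [mul_apply_eq_comp, ContinuousLinearMap.star_eq_adjoint,
    ContinuousLinearMap.adjoint_inner_right, real_inner_self_eq_norm_sq]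

theorem traceForm_star_self_nonneg (X : E →L[ℝ] E) : 0 ≤ traceForm (star X) X := by
  rw [traceForm_star_self]; positivity

theorem eq_zero_of_traceForm_star_self {X : E →L[ℝ] E} (h : traceForm (star X) X ≤ 0) :
    X = 0 := by
  have h' := le_antisymm h (traceForm_star_self_nonneg X)
  rw [traceForm_star_self, Finset.sum_eq_zero_iff_of_nonneg (fun _ _ => by positivity)] at h'
  have : (X : E →ₗ[ℝ] E) = 0 := (stdOrthonormalBasis ℝ E).toBasis.ext fun i => by
    simpa using h' i (Finset.mem_univ i)
  exact ContinuousLinearMap.coe_injective this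

/-- Taking adjoints preserves the trace form but here changes its sign. -/
theorem traceForm_eq_zero_of_symm_of_skew {X Y : E →L[ℝ] E} (hX : star X = X)
    (hY : star Y = -Y) : traceForm X Y = 0 := by
  have := traceForm_star_star X Y
  rw [hX, hY, map_neg] at this
  linarith

/-- The exponential is injective at zero on symmetric operators. -/
theorem eq_zero_of_exp_eq_one {H : E →L[ℝ] E} (hH : star H = H) (h : NormedSpace.exp H = 1) :
    H = 0 := by
  have hs : (H : E →ₗ[ℝ] E).IsSymmetric := by
    have : IsSelfAdjoint H := hH
    exact this.isSymmetric
  have : (H : E →ₗ[ℝ] E) = 0 := (hs.eigenvectorBasis rfl).toBasis.ext fun i => by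
    have h1 : H (hs.eigenvectorBasis rfl i)
        = hs.eigenvalues rfl i • hs.eigenvectorBasis rfl i :=
      hs.apply_eigenvectorBasis rfl i
    have h2 := exp_apply_of_apply_eq_smul h1
    rw [h, one_apply_eq_self] at h2
    have h3 : (hs.eigenvectorBasis rfl i) ≠ 0 := (hs.eigenvectorBasis rfl).orthonormal.ne_zero i
    have h4 : (1 - Real.exp (hs.eigenvalues rfl i)) • hs.eigenvectorBasis rfl i = 0 := by
      rw [sub_smul, one_smul, ← h2, sub_self]
    have h5 := (smul_eq_zero.1 h4).resolve_right h3
    have h6 : hs.eigenvalues rfl i = 0 := Real.exp_eq_one_iff _ |>.1 (by linarith)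
    simp only [OrthonormalBasis.coe_toBasis]
    exact h1.trans (by rw [h6, zero_smul]; rfl)
  exact ContinuousLinearMap.coe_injective this

/-- If an orthogonal operator and its inverse have the same trace as `exp H` and `exp (-H)` with
`H` symmetric, then `H = 0`. -/
theorem eq_zero_of_trace_unitary {H u : E →L[ℝ] E} (hH : star H = H) (hu : star u * u = 1)
    (h1 : traceForm 1 u = traceForm 1 (NormedSpace.exp H))
    (h2 : traceForm 1 (star u) = traceForm 1 (NormedSpace.exp (-H))) : H = 0 := by
  have hstar : ∀ c : ℝ, star (NormedSpace.exp (c • H)) = NormedSpace.exp (c • H) := fun c => by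
    rw [NormedSpace.star_exp, star_smul, hH, star_trivial]
  have hadd : ∀ c d : ℝ, NormedSpace.exp (c • H) * NormedSpace.exp (d • H)
      = NormedSpace.exp ((c + d) • H) := fun c d => by
    rw [add_smul, exp_add_of_commute' (((Commute.refl H).smul_left c).smul_right d)]
  -- `S = 2 sinh(H/2)`. The hypotheses make the traces of `S* S = exp H + exp(-H) - 2` and `(u-1)*
  -- (u-1) = 2 - u - u*` opposite. Both are nonnegative, so `S = 0`, and `exp H = 1` follows.
  set S := NormedSpace.exp ((1 / 2 : ℝ) • H) - NormedSpace.exp ((-1 / 2 : ℝ) • H) with hS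
  have hSS : star S * S = NormedSpace.exp H + NormedSpace.exp (-H) - 2 := by
    rw [hS, star_sub, hstar, hstar, sub_mul, mul_sub, mul_sub, hadd, hadd, hadd, hadd]
    norm_num
    rw [← one_add_one_eq_two]
    abel
  have hUU : star (u - 1) * (u - 1) = 2 - u - star u := by
    rw [star_sub, star_one, sub_mul, mul_sub, mul_sub, hu]
    simp only [one_mul, mul_one]
    rw [← one_add_one_eq_two]
    abel
  have e1 : ∀ X : E →L[ℝ] E, traceForm (star X) X = traceForm 1 (star X * X) := fun X => by
    rw [← traceForm_mul_left, one_mul]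
  have hS0 : S = 0 := eq_zero_of_traceForm_star_self (by
    have := traceForm_star_self_nonneg (u - 1)
    rw [e1, hUU, map_sub, map_sub] at this
    rw [e1, hSS, map_sub, map_add]
    linarith)
  refine eq_zero_of_exp_eq_one hH ?_
  have h3 := sub_eq_zero.1 hS0
  have h4 := hadd (1 / 2) (1 / 2)
  nth_rw 2 [h3] at h4
  rw [hadd] at h4
  norm_num at h4
  exact h4.symm

end Trace

/-! ### The Cartan decomposition, the action of `K`, and maximal commutative subspaces. -/

section Lie

variable {E : Type*} [NormedAddCommGroup E] [InnerProductSpace ℝ E] [FiniteDimensional ℝ E]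
  [CompleteSpace E]

namespace ReductiveLieAlgebra

variable (𝔤 : ReductiveLieAlgebra E)

theorem star_eq_of_mem_symmPart {X : E →L[ℝ] E} (hX : X ∈ 𝔤.𝔰) : star X = X :=
  neg_injective hX.2

theorem star_eq_of_mem_skewPart {X : E →L[ℝ] E} (hX : X ∈ skewPart 𝔤.toLieSubalgebra) :
    star X = -X := by
  rw [← hX.2, neg_neg, hX.2]

theorem star_mem {X : E →L[ℝ] E} (hX : X ∈ 𝔤.toLieSubalgebra) : star X ∈ 𝔤.toLieSubalgebra := by
  simpa using neg_mem (𝔤.cartan_mem X hX)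

theorem lie_eq (X Y : E →L[ℝ] E) : ⁅X, Y⁆ = X * Y - Y * X := rfl

theorem exp_mem_unitary {X : E →L[ℝ] E} (hX : star X = -X) :
    NormedSpace.exp X ∈ unitary (E →L[ℝ] E) := by
  rw [Unitary.mem_iff, NormedSpace.star_exp, hX]
  exact ⟨exp_neg_mul_exp' _, exp_mul_exp_neg' _⟩

theorem star_eq_inv_of_mem_K {k : (E →L[ℝ] E)ˣ} (hk : k ∈ 𝔤.K) :
    star (k : E →L[ℝ] E) = ((k⁻¹ : (E →L[ℝ] E)ˣ) : E →L[ℝ] E) := by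
  have : (k : E →L[ℝ] E) ∈ unitary (E →L[ℝ] E) := by
    induction hk using Subgroup.closure_induction with
    | mem x hx =>
      obtain ⟨X, hX, rfl⟩ := hx
      exact exp_mem_unitary (𝔤.star_eq_of_mem_skewPart hX)
    | one => exact one_mem _
    | mul x y _ _ hx hy => exact mul_mem hx hy
    | inv x _ hx =>
      have : ((x⁻¹ : (E →L[ℝ] E)ˣ) : E →L[ℝ] E) = star (x : E →L[ℝ] E) :=
        Units.inv_eq_of_mul_eq_one_left (Unitary.mem_iff.1 hx).1
      rw [this]
      exact Unitary.star_mem hx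
  exact (Units.inv_eq_of_mul_eq_one_left (Unitary.mem_iff.1 this).1).symm

theorem conj_mem_of_mem_K {k : (E →L[ℝ] E)ˣ} (hk : k ∈ 𝔤.K) {X : E →L[ℝ] E}
    (hX : X ∈ 𝔤.toLieSubalgebra) :
    (k : E →L[ℝ] E) * X * ((k⁻¹ : (E →L[ℝ] E)ˣ) : E →L[ℝ] E) ∈ 𝔤.toLieSubalgebra := by
  have key : ∀ T ∈ 𝔤.toLieSubalgebra, ∀ X ∈ 𝔤.toLieSubalgebra,
      NormedSpace.exp T * X * NormedSpace.exp (-T) ∈ 𝔤.toLieSubalgebra := fun T hT X hX =>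
    exp_conj_mem (isClosed_submodule 𝔤.toLieSubalgebra.toSubmodule)
      (fun Y hY => 𝔤.toLieSubalgebra.lie_mem hT hY) hX
  induction hk using Subgroup.closure_induction'' generalizing X with
  | mem x hx =>
    obtain ⟨T, hT, rfl⟩ := hx
    exact key T hT.1 X hX
  | inv_mem x hx =>
    obtain ⟨T, hT, rfl⟩ := hx
    simpa [expGL] using key (-T) (neg_mem hT.1) X hX
  | one => simpa using hX
  | mul x y _ _ hx hy => simpa [mul_assoc] using hx (hy hX)

theorem star_conj_mem_symmPart {k : (E →L[ℝ] E)ˣ} (hk : k ∈ 𝔤.K) {X : E →L[ℝ] E}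
    (hX : X ∈ 𝔤.𝔰) : star (k : E →L[ℝ] E) * X * (k : E →L[ℝ] E) ∈ 𝔤.𝔰 := by
  refine ⟨?_, ?_⟩
  · rw [𝔤.star_eq_inv_of_mem_K hk]
    simpa using 𝔤.conj_mem_of_mem_K (inv_mem hk) hX.1
  · rw [star_mul, star_mul, star_star, 𝔤.star_eq_of_mem_symmPart hX, mul_assoc]

variable {𝔞 : Submodule ℝ (E →L[ℝ] E)}

variable {𝔤}

theorem IsMaximalCommutative.commute (h𝔞 : 𝔤.IsMaximalCommutative 𝔞) {X Y : E →L[ℝ] E}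
    (hX : X ∈ 𝔞) (hY : Y ∈ 𝔞) :
    Commute X Y :=
  sub_eq_zero.1 (h𝔞.1.2 X hX Y hY)

theorem IsMaximalCommutative.star_eq (h𝔞 : 𝔤.IsMaximalCommutative 𝔞) {X : E →L[ℝ] E} (hX : X ∈ 𝔞) : star X = X :=
  𝔤.star_eq_of_mem_symmPart (h𝔞.1.1 hX)

/-- A maximal commutative subspace contains its centralizer in `𝔰`. -/
theorem IsMaximalCommutative.mem_of_commute (h𝔞 : 𝔤.IsMaximalCommutative 𝔞) {X : E →L[ℝ] E}
    (hX : X ∈ 𝔤.𝔰)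
    (hc : ∀ H ∈ 𝔞, Commute H X) : X ∈ 𝔞 := by
  have hle : 𝔞 ⊔ Submodule.span ℝ {X} ≤ 𝔞 := by
    refine h𝔞.2 ⟨sup_le h𝔞.1.1 (by simpa using hX), ?_⟩ le_sup_left
    intro Y hY Z hZ
    obtain ⟨Y₁, hY₁, Y₂, hY₂, rfl⟩ := Submodule.mem_sup.1 hY
    obtain ⟨Z₁, hZ₁, Z₂, hZ₂, rfl⟩ := Submodule.mem_sup.1 hZ
    obtain ⟨c, rfl⟩ := Submodule.mem_span_singleton.1 hY₂
    obtain ⟨d, rfl⟩ := Submodule.mem_span_singleton.1 hZ₂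
    refine sub_eq_zero.2 (Commute.eq ?_)
    refine ((h𝔞.commute hY₁ hZ₁).add_right ((hc _ hY₁).smul_right d)).add_left
      (Commute.add_right ((hc _ hZ₁).symm.smul_left c)
        (((Commute.refl X).smul_left c).smul_right d))
  exact hle (Submodule.mem_sup_right (Submodule.mem_span_singleton_self X))

end ReductiveLieAlgebra

end Lie

end RealReductive

namespace RealReductive

/-! ### Restricted roots, nilpotency of `𝔫`, the infinitesimal Iwasawa decomposition, and uniqueness
in `KAN`. -/

section Roots

variable {E : Type*} [NormedAddCommGroup E] [InnerProductSpace ℝ E] [FiniteDimensional ℝ E]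
  [CompleteSpace E]

namespace ReductiveLieAlgebra

variable {𝔤 : ReductiveLieAlgebra E} {𝔞 : Submodule ℝ (E →L[ℝ] E)}

theorem lie_mem_rootSpace {α β : Module.Dual ℝ 𝔞} {X Y : E →L[ℝ] E}
    (hX : X ∈ 𝔤.rootSpace 𝔞 α) (hY : Y ∈ 𝔤.rootSpace 𝔞 β) :
    X * Y - Y * X ∈ 𝔤.rootSpace 𝔞 (α + β) := by
  refine ⟨𝔤.toLieSubalgebra.lie_mem hX.1 hY.1, fun H => ?_⟩
  rw [← lie_eq, leibniz_lie, hX.2, hY.2, smul_lie, lie_smul, LinearMap.add_apply, add_smul]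

/-- Elements of `𝔞` are symmetric, so the adjoint of `[H, X]` is `-[H, X*]`. -/
theorem star_mem_rootSpace (h𝔞 : 𝔤.IsMaximalCommutative 𝔞) {α : Module.Dual ℝ 𝔞}
    {X : E →L[ℝ] E} (hX : X ∈ 𝔤.rootSpace 𝔞 α) : star X ∈ 𝔤.rootSpace 𝔞 (-α) := by
  refine ⟨𝔤.star_mem hX.1, fun H => ?_⟩
  have h := congrArg star (hX.2 H)
  rw [lie_eq, star_sub, star_mul, star_mul, h𝔞.star_eq H.2, star_smul,
    star_trivial (α H)] at h
  rw [lie_eq, LinearMap.neg_apply, neg_smul, ← h, neg_sub]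

theorem rootSpace_le_nilpotentPart {H₀ : 𝔞} {α : Module.Dual ℝ 𝔞} (hα : 0 < α H₀) :
    𝔤.rootSpace 𝔞 α ≤ 𝔤.nilpotentPart 𝔞 H₀ := by
  by_cases h : 𝔤.rootSpace 𝔞 α = ⊥
  · rw [h]; exact bot_le
  · refine le_iSup₂_of_le α ⟨⟨?_, h⟩, hα⟩ le_rfl
    rintro rfl
    simp at hα

theorem nilpotentPart_le {H₀ : 𝔞} {W : Submodule ℝ (E →L[ℝ] E)}
    (h : ∀ α : Module.Dual ℝ 𝔞, 0 < α H₀ → 𝔤.rootSpace 𝔞 α ≤ W) :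
    𝔤.nilpotentPart 𝔞 H₀ ≤ W :=
  iSup₂_le fun α hα => h α hα.2

/-- The map `X ↦ X Y - Y X`. -/
def lieRight (Y : E →L[ℝ] E) : (E →L[ℝ] E) →ₗ[ℝ] (E →L[ℝ] E) :=
  LinearMap.mulRight ℝ Y - LinearMap.mulLeft ℝ Y

theorem lieRight_apply (X Y : E →L[ℝ] E) : lieRight Y X = X * Y - Y * X := rfl

theorem lie_mem_nilpotentPart {H₀ : 𝔞} {X Y : E →L[ℝ] E} (hX : X ∈ 𝔤.nilpotentPart 𝔞 H₀)
    (hY : Y ∈ 𝔤.nilpotentPart 𝔞 H₀) : X * Y - Y * X ∈ 𝔤.nilpotentPart 𝔞 H₀ := by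
  have h : 𝔤.nilpotentPart 𝔞 H₀ ≤ (𝔤.nilpotentPart 𝔞 H₀).comap (lieRight Y) := by
    refine nilpotentPart_le fun α hα X hX => ?_
    have h' : 𝔤.nilpotentPart 𝔞 H₀ ≤ (𝔤.nilpotentPart 𝔞 H₀).comap (lieRight X) := by
      refine nilpotentPart_le fun β hβ Y hY => ?_
      exact rootSpace_le_nilpotentPart (by simpa using add_pos hβ hα) (lie_mem_rootSpace hY hX)
    rw [Submodule.mem_comap, lieRight_apply, ← neg_sub]
    exact neg_mem (h' hY)
  exact h hX

theorem lie_mem_nilpotentPart_of_mem {H₀ : 𝔞} {H X : E →L[ℝ] E} (hH : H ∈ 𝔞)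
    (hX : X ∈ 𝔤.nilpotentPart 𝔞 H₀) : H * X - X * H ∈ 𝔤.nilpotentPart 𝔞 H₀ := by
  have h : 𝔤.nilpotentPart 𝔞 H₀ ≤ (𝔤.nilpotentPart 𝔞 H₀).comap (lieRight H) := by
    refine nilpotentPart_le fun α hα X hX => ?_
    rw [Submodule.mem_comap, lieRight_apply, ← neg_sub]
    have := hX.2 ⟨H, hH⟩
    rw [lie_eq] at this
    rw [this]
    exact neg_mem (Submodule.smul_mem _ _ (rootSpace_le_nilpotentPart hα hX))
  rw [← neg_sub]
  exact neg_mem (h hX)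

variable (𝔤 𝔞) in
/-- The sum of the root spaces of the roots `α` with `c ≤ α(H₀)`. -/
def rootFiltration (H₀ : 𝔞) (c : ℝ) : Submodule ℝ (E →L[ℝ] E) :=
  ⨆ (α : Module.Dual ℝ 𝔞) (_ : c ≤ α H₀), 𝔤.rootSpace 𝔞 α

theorem lie_mem_rootFiltration {H₀ : 𝔞} {c d : ℝ} {X Y : E →L[ℝ] E}
    (hX : X ∈ 𝔤.rootFiltration 𝔞 H₀ c) (hY : Y ∈ 𝔤.rootFiltration 𝔞 H₀ d) :
    X * Y - Y * X ∈ 𝔤.rootFiltration 𝔞 H₀ (c + d) := by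
  have h : 𝔤.rootFiltration 𝔞 H₀ c ≤ (𝔤.rootFiltration 𝔞 H₀ (c + d)).comap (lieRight Y) := by
    refine iSup₂_le fun α hα X hX => ?_
    have h' : 𝔤.rootFiltration 𝔞 H₀ d ≤ (𝔤.rootFiltration 𝔞 H₀ (c + d)).comap (lieRight X) := by
      refine iSup₂_le fun β hβ Y hY => ?_
      refine (le_iSup₂_of_le (β + α) ?_ le_rfl : _ ≤ 𝔤.rootFiltration 𝔞 H₀ (c + d))
        (lie_mem_rootSpace hY hX)
      simpa [add_comm] using add_le_add hβ hα
    rw [Submodule.mem_comap, lieRight_apply, ← neg_sub]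
    exact neg_mem (h' hY)
  exact h hX

theorem exists_nilpotentPart_le_rootFiltration (H₀ : 𝔞) :
    ∃ δ > 0, 𝔤.nilpotentPart 𝔞 H₀ ≤ 𝔤.rootFiltration 𝔞 H₀ δ := by
  have hfin : (𝔤.posRoots 𝔞 H₀).Finite := (𝔤.finite_roots 𝔞).subset fun α h => h.1
  rcases (𝔤.posRoots 𝔞 H₀).eq_empty_or_nonempty with h | h
  · exact ⟨1, one_pos, by rw [nilpotentPart, h]; simp⟩
  · obtain ⟨α, hα, hmin⟩ := Set.exists_min_image _ (fun α => α H₀) hfin h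
    exact ⟨α H₀, hα.2, iSup₂_le fun β hβ => le_iSup₂_of_le β (hmin β hβ) le_rfl⟩

theorem exists_rootFiltration_eq_bot (H₀ : 𝔞) :
    ∃ M : ℝ, ∀ c > M, 𝔤.rootFiltration 𝔞 H₀ c = ⊥ := by
  obtain ⟨M, hM⟩ := ((𝔤.finite_roots 𝔞).image fun α => α H₀).bddAbove
  -- The maximum with `0` rules out `α = 0`, which is not a root although its eigenspace may be
  -- nonzero.
  refine ⟨max M 0, fun c hc => ?_⟩
  rw [rootFiltration, eq_bot_iff]
  refine iSup₂_le fun α hα => ?_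
  by_contra hne
  have h0 : 0 < α H₀ := lt_of_lt_of_le ((le_max_right _ _).trans_lt hc) hα
  have hα' : α ∈ 𝔤.roots 𝔞 := ⟨fun h => by simp [h] at h0, fun h => hne h.le⟩
  have : α H₀ ≤ M := hM ⟨α, hα', rfl⟩
  exact absurd (hα.trans this) (not_le.2 ((le_max_left _ _).trans_lt hc))

/-- This is nilpotency of `𝔫` in the form the integral curve argument needs. A bracket with `𝔫`
raises the weight with respect to `H₀` by at least some `δ > 0`, so `𝔪` lies in arbitrarily high
steps of the root filtration, and these vanish. -/
theorem eq_bot_of_le_span_lie {H₀ : 𝔞} {𝔪 : Submodule ℝ (E →L[ℝ] E)}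
    (h𝔪 : 𝔪 ≤ 𝔤.nilpotentPart 𝔞 H₀)
    (h : 𝔪 ≤ Submodule.span ℝ {Z | ∃ X ∈ 𝔤.nilpotentPart 𝔞 H₀, ∃ Y ∈ 𝔪, Z = X * Y - Y * X}) :
    𝔪 = ⊥ := by
  obtain ⟨δ, hδ, hle⟩ := 𝔤.exists_nilpotentPart_le_rootFiltration H₀
  obtain ⟨M, hM⟩ := 𝔤.exists_rootFiltration_eq_bot H₀
  have key : ∀ j : ℕ, 𝔪 ≤ 𝔤.rootFiltration 𝔞 H₀ (j * δ + δ) := by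
    intro j
    induction j with
    | zero => simpa using h𝔪.trans hle
    | succ j ih =>
      refine h.trans (Submodule.span_le.2 ?_)
      rintro Z ⟨X, hX, Y, hY, rfl⟩
      have := lie_mem_rootFiltration (hle hX) (ih hY)
      rwa [show δ + (j * δ + δ) = (j + 1 : ℕ) * δ + δ by push_cast; ring] at this
  obtain ⟨j, hj⟩ := exists_nat_gt (M / δ)
  rw [div_lt_iff₀ hδ] at hj
  have := key j
  rwa [hM _ (by linarith), le_bot_iff] at this

/-- On a root space, `α(H₀) tr(HX) = tr(H [H₀, X]) = tr([H, H₀] X) = 0`, and `α(H₀) ≠ 0`. -/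
theorem traceForm_eq_zero_of_mem_nilpotentPart (h𝔞 : 𝔤.IsMaximalCommutative 𝔞) {H₀ : 𝔞}
    {H X : E →L[ℝ] E} (hH : H ∈ 𝔞) (hX : X ∈ 𝔤.nilpotentPart 𝔞 H₀) : traceForm H X = 0 := by
  have h : 𝔤.nilpotentPart 𝔞 H₀ ≤ LinearMap.ker (traceForm H) := by
    refine nilpotentPart_le fun α hα X hX => ?_
    have h1 := hX.2 H₀
    have h2 : traceForm H (α H₀ • X) = 0 := by
      rw [← h1, lie_eq, map_sub, ← traceForm_mul_left, ← traceForm_mul_left,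
        traceForm_comm (H * X), ← traceForm_mul_left, (h𝔞.commute H₀.2 hH).eq, sub_self]
    rw [map_smul, smul_eq_mul] at h2
    exact (mul_eq_zero.1 h2).resolve_left hα.ne'
  exact h hX

/-- The Iwasawa decomposition of the Lie algebra. -/
theorem mem_skewPart_sup_sup (h𝔞 : 𝔤.IsMaximalCommutative 𝔞) {H₀ : 𝔞}
    (hH₀ : 𝔤.IsRegular 𝔞 H₀) {X : E →L[ℝ] E} (hX : X ∈ 𝔤.toLieSubalgebra) :
    X ∈ skewPart 𝔤.toLieSubalgebra ⊔ (𝔞 ⊔ 𝔤.nilpotentPart 𝔞 H₀) := by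
  set L := 𝔤.toLieSubalgebra
  have h𝔞L : ∀ H : 𝔞, (H : E →L[ℝ] E) ∈ L := fun H => (h𝔞.1.1 H.2).1
  -- For the inner product `tr(X* Y)` on `𝔤` the operators `ad H`, `H ∈ 𝔞`, are symmetric. They
  -- commute, so `𝔤` is the sum of their joint eigenspaces.
  let B : L →ₗ[ℝ] L →ₗ[ℝ] ℝ := LinearMap.mk₂ ℝ
    (fun X Y => traceForm (star (X : E →L[ℝ] E)) (Y : E →L[ℝ] E))
    (fun X Y Z => by simp) (fun c X Y => by simp) (fun X Y Z => by simp) (fun c X Y => by simp)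
  let T : 𝔞 → L →ₗ[ℝ] L := fun H => LieAlgebra.ad ℝ L ⟨H, h𝔞L H⟩
  have hT : ∀ (H : 𝔞) (X : L), ((T H X : L) : E →L[ℝ] E) = H * X - X * H := fun H X => rfl
  have htop := iSup_iInf_eigenspace_eq_top_of_symm B (T := T)
    (fun X Y => by
      change traceForm _ _ = traceForm _ _
      rw [← traceForm_star_star, star_star, traceForm_comm])
    (fun X => traceForm_star_self_nonneg _)
    (fun X h => Subtype.ext (eq_zero_of_traceForm_star_self h.le))
    (fun H X Y => by
      change traceForm _ _ = traceForm _ _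
      rw [hT, hT, star_sub, star_mul, star_mul, h𝔞.star_eq H.2, map_sub, map_sub,
        LinearMap.sub_apply, traceForm_mul_left, traceForm_mul_left, traceForm_comm (H : E →L[ℝ] E),
        traceForm_mul_left])
    (fun H H' => by
      refine sub_eq_zero.1 ?_
      ext X
      simp only [LinearMap.sub_apply, Module.End.mul_apply, AddSubgroupClass.coe_sub, hT]
      have := (h𝔞.commute H.2 H'.2).eq
      simp only [mul_sub, sub_mul, mul_assoc, this]
      simp only [← mul_assoc, this]
      simp
      abel)
  have hX' : (⟨X, hX⟩ : L) ∈ ⨆ χ : 𝔞 → ℝ, ⨅ i, Module.End.eigenspace (T i) (χ i) :=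
    htop ▸ Submodule.mem_top
  suffices ∀ Y : L, Y ∈ (⨆ χ : 𝔞 → ℝ, ⨅ i, Module.End.eigenspace (T i) (χ i)) →
      (Y : E →L[ℝ] E) ∈ skewPart L ⊔ (𝔞 ⊔ 𝔤.nilpotentPart 𝔞 H₀) from this _ hX'
  intro Y hY
  refine Submodule.iSup_induction (motive := fun Y : L => (Y : E →L[ℝ] E) ∈
    skewPart L ⊔ (𝔞 ⊔ 𝔤.nilpotentPart 𝔞 H₀)) _ hY ?_ (zero_mem _) (fun Y Z hY hZ => add_mem hY hZ)
  intro χ Y hY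
  rw [Submodule.mem_iInf] at hY
  by_cases hY0 : (Y : E →L[ℝ] E) = 0
  · rw [hY0]; exact zero_mem _
  have hχ : ∀ H : 𝔞, ⁅(H : E →L[ℝ] E), (Y : E →L[ℝ] E)⁆ = χ H • (Y : E →L[ℝ] E) := fun H =>
    congrArg Subtype.val (Module.End.mem_eigenspace_iff.1 (hY H))
  have hinj : Function.Injective fun c : ℝ => c • (Y : E →L[ℝ] E) := smul_left_injective ℝ hY0
  let α : Module.Dual ℝ 𝔞 :=
    { toFun := χ
      map_add' := fun H H' => hinj (by
        simp only [add_smul]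
        rw [← hχ, ← hχ, ← hχ, Submodule.coe_add, add_lie])
      map_smul' := fun c H => hinj (by
        simp only [RingHom.id_apply, smul_assoc]
        rw [← hχ, ← hχ, Submodule.coe_smul, smul_lie]) }
  have hα : (Y : E →L[ℝ] E) ∈ 𝔤.rootSpace 𝔞 α := ⟨Y.2, hχ⟩
  have hs := star_mem_rootSpace h𝔞 hα
  have hskew : (Y : E →L[ℝ] E) - star (Y : E →L[ℝ] E) ∈ skewPart L :=
    ⟨sub_mem hα.1 hs.1, by rw [star_sub, star_star, neg_sub]⟩
  have hsymm : (Y : E →L[ℝ] E) + star (Y : E →L[ℝ] E) ∈ symmPart L :=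
    ⟨add_mem hα.1 hs.1, by rw [star_add, star_star, add_comm]⟩
  -- For `α = 0` the symmetric part of `Y` centralizes `𝔞` and so lies in it by maximality. For a
  -- negative root, `Y = (Y - Y*) + Y*` with `Y*` in a positive root space.
  by_cases h0 : α = 0
  · have hmem : (Y : E →L[ℝ] E) + star (Y : E →L[ℝ] E) ∈ 𝔞 := by
      refine h𝔞.mem_of_commute hsymm fun H hH => sub_eq_zero.1 ?_
      have h1 := hα.2 ⟨H, hH⟩
      have h2 := hs.2 ⟨H, hH⟩
      rw [← lie_eq, lie_add, h1, h2, h0]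
      simp
    have : (Y : E →L[ℝ] E) = (1 / 2 : ℝ) • ((Y : E →L[ℝ] E) - star (Y : E →L[ℝ] E))
        + (1 / 2 : ℝ) • ((Y : E →L[ℝ] E) + star (Y : E →L[ℝ] E)) := by
      module
    rw [this]
    exact add_mem (Submodule.smul_mem _ _ (Submodule.mem_sup_left hskew))
      (Submodule.smul_mem _ _ (Submodule.mem_sup_right (Submodule.mem_sup_left hmem)))
  have hroot : α ∈ 𝔤.roots 𝔞 := ⟨h0, fun h => hY0 (by rwa [h, Submodule.mem_bot] at hα)⟩
  rcases lt_or_gt_of_ne (hH₀ α hroot) with hlt | hgt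
  · have := rootSpace_le_nilpotentPart (H₀ := H₀) (by simpa using hlt) hs
    rw [← sub_add_cancel (Y : E →L[ℝ] E) (star (Y : E →L[ℝ] E))]
    exact add_mem (Submodule.mem_sup_left hskew)
      (Submodule.mem_sup_right (Submodule.mem_sup_right this))
  · exact Submodule.mem_sup_right (Submodule.mem_sup_right (rootSpace_le_nilpotentPart hgt hα))

/-- Conjugation by `exp (-s H₀)` contracts `𝔫` as `s → ∞`. -/
theorem tendsto_exp_conj_nilpotentPart {H₀ : 𝔞} {Z : E →L[ℝ] E}
    (hZ : Z ∈ 𝔤.nilpotentPart 𝔞 H₀) :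
    Tendsto (fun s : ℝ => NormedSpace.exp (-s • (H₀ : E →L[ℝ] E)) * Z
      * NormedSpace.exp (-(-s • (H₀ : E →L[ℝ] E)))) atTop (𝓝 0) := by
  -- The contracted elements form a subspace, so root vectors suffice; on those, conjugation is
  -- multiplication by `exp(-s α(H₀))`.
  let W : Submodule ℝ (E →L[ℝ] E) :=
    { carrier := {Z | Tendsto (fun s : ℝ => NormedSpace.exp (-s • (H₀ : E →L[ℝ] E)) * Z
        * NormedSpace.exp (-(-s • (H₀ : E →L[ℝ] E)))) atTop (𝓝 0)}
      zero_mem' := by simp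
      add_mem' := fun {X Y} hX hY => by
        simpa [mul_add, add_mul] using Tendsto.add hX hY
      smul_mem' := fun c X hX => by
        simpa using Tendsto.const_smul hX c }
  have : 𝔤.nilpotentPart 𝔞 H₀ ≤ W := nilpotentPart_le fun α hα Z hZ => by
    have h1 : ∀ s : ℝ, NormedSpace.exp (-s • (H₀ : E →L[ℝ] E)) * Z
        * NormedSpace.exp (-(-s • (H₀ : E →L[ℝ] E))) = Real.exp (-s * α H₀) • Z := fun s => by
      refine exp_conj_of_eq_smul ?_
      rw [smul_mul_assoc, mul_smul_comm, ← smul_sub, ← lie_eq, hZ.2, smul_smul]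
    change Tendsto _ _ _
    simp_rw [h1]
    have h2 : Tendsto (fun s : ℝ => -s * α H₀) atTop atBot :=
      (tendsto_neg_atTop_atBot).atBot_mul_const hα
    simpa using (Real.tendsto_exp_atBot.comp h2).smul_const Z
  exact this hZ

/-- Conjugation by `exp (-s H₀)` contracts `N` as `s → ∞`. -/
theorem tendsto_exp_conj_N {H₀ : 𝔞} {n : (E →L[ℝ] E)ˣ} (hn : n ∈ 𝔤.N 𝔞 H₀) :
    Tendsto (fun s : ℝ => expGL (-s • (H₀ : E →L[ℝ] E)) * n
      * (expGL (-s • (H₀ : E →L[ℝ] E)))⁻¹) atTop (𝓝 1) := by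
  induction hn using Subgroup.closure_induction with
  | mem x hx =>
    obtain ⟨Z, hZ, rfl⟩ := hx
    rw [(Units.isOpenEmbedding_val (R := E →L[ℝ] E)).isInducing.tendsto_nhds_iff]
    have h := (continuous_exp'.tendsto _).comp (tendsto_exp_conj_nilpotentPart hZ)
    rw [NormedSpace.exp_zero] at h
    refine h.congr fun s => ?_
    let _ : NormedAlgebra ℚ (E →L[ℝ] E) := NormedAlgebra.restrictScalars ℚ ℝ (E →L[ℝ] E)
    exact NormedSpace.exp_units_conj (expGL (-s • (H₀ : E →L[ℝ] E))) Z
  | one => simp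
  | mul x y _ _ hx hy =>
    have := hx.mul hy
    rw [one_mul] at this
    exact this.congr fun s => by group
  | inv x _ hx =>
    have := hx.inv
    rw [inv_one] at this
    exact this.congr fun s => by group

/-- Since `exp H` commutes with `exp(-s H₀)`, replacing `n` by its conjugate does not change the
trace, and the conjugates tend to `1`. -/
theorem traceForm_exp_mul_of_mem_N (h𝔞 : 𝔤.IsMaximalCommutative 𝔞) {H₀ : 𝔞}
    {n : (E →L[ℝ] E)ˣ} (hn : n ∈ 𝔤.N 𝔞 H₀) {H : E →L[ℝ] E} (hH : H ∈ 𝔞) :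
    traceForm (NormedSpace.exp H) (n : E →L[ℝ] E) = traceForm 1 (NormedSpace.exp H) := by
  have h1 : Tendsto (fun s : ℝ => traceForm (NormedSpace.exp H)
      ((expGL (-s • (H₀ : E →L[ℝ] E)) * n * (expGL (-s • (H₀ : E →L[ℝ] E)))⁻¹ :
        (E →L[ℝ] E)ˣ) : E →L[ℝ] E)) atTop (𝓝 (traceForm (NormedSpace.exp H) 1)) :=
    (((LinearMap.continuous_of_finiteDimensional (traceForm (NormedSpace.exp H))).comp
      Units.continuous_val).tendsto _).comp (tendsto_exp_conj_N hn)
  rw [traceForm_comm 1]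
  refine tendsto_nhds_unique (tendsto_const_nhds.congr fun s => ?_) h1
  set a : (E →L[ℝ] E)ˣ := expGL (-s • (H₀ : E →L[ℝ] E)) with ha
  have hc : Commute (NormedSpace.exp H) (a : E →L[ℝ] E) := by
    have h2 : Commute H (-s • (H₀ : E →L[ℝ] E)) := (h𝔞.commute hH H₀.2).smul_right _
    change NormedSpace.exp H * NormedSpace.exp _ = NormedSpace.exp _ * NormedSpace.exp H
    rw [← exp_add_of_commute' h2, ← exp_add_of_commute' h2.symm, add_comm]
  rw [Units.val_mul, Units.val_mul, ← traceForm_mul_left, ← mul_assoc, hc.eq,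
    traceForm_comm (_ * _ * _), mul_assoc, ← traceForm_mul_left, Units.inv_mul,
    ← traceForm_mul_left, one_mul]

/-- The element `u = k₂⁻¹ k₁` of `K` equals `exp(H₂) n exp(-H₁)` with `n ∈ N`. So `u` and `u⁻¹ = u*`
have the traces of `exp(H₂ - H₁)` and `exp(H₁ - H₂)`, and `eq_zero_of_trace_unitary` applies. -/
theorem iwasawa_unique (h𝔞 : 𝔤.IsMaximalCommutative 𝔞) {H₀ H₁ H₂ : 𝔞}
    {k₁ k₂ n₁ n₂ : (E →L[ℝ] E)ˣ} (hk₁ : k₁ ∈ 𝔤.K) (hk₂ : k₂ ∈ 𝔤.K) (hn₁ : n₁ ∈ 𝔤.N 𝔞 H₀)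
    (hn₂ : n₂ ∈ 𝔤.N 𝔞 H₀)
    (h : k₁ * expGL (H₁ : E →L[ℝ] E) * n₁ = k₂ * expGL (H₂ : E →L[ℝ] E) * n₂) : H₁ = H₂ := by
  have hexp : ∀ H H' : 𝔞, NormedSpace.exp (-(H' : E →L[ℝ] E)) * NormedSpace.exp (H : E →L[ℝ] E)
      = NormedSpace.exp ((H - H' : 𝔞) : E →L[ℝ] E) := fun H H' => by
    rw [← exp_add_of_commute' (h𝔞.commute H'.2 H.2).neg_left, neg_add_eq_sub,
      AddSubgroupClass.coe_sub]
  have htr : ∀ (H H' : 𝔞) (n : (E →L[ℝ] E)ˣ), n ∈ 𝔤.N 𝔞 H₀ →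
      traceForm 1 ((expGL (H : E →L[ℝ] E) * n * (expGL (H' : E →L[ℝ] E))⁻¹ : (E →L[ℝ] E)ˣ) :
        E →L[ℝ] E) = traceForm 1 (NormedSpace.exp ((H - H' : 𝔞) : E →L[ℝ] E)) := by
    intro H H' n hn
    rw [← traceForm_exp_mul_of_mem_N h𝔞 hn (H - H').2, ← hexp, Units.val_mul,
      ← traceForm_mul_left, one_mul, traceForm_comm, Units.val_mul, ← traceForm_mul_left]
    rfl
  set u := k₂⁻¹ * k₁ with hu
  have hu1 : u = expGL (H₂ : E →L[ℝ] E) * (n₂ * n₁⁻¹) * (expGL (H₁ : E →L[ℝ] E))⁻¹ := by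
    have : k₁ = k₂ * expGL (H₂ : E →L[ℝ] E) * n₂ * n₁⁻¹ * (expGL (H₁ : E →L[ℝ] E))⁻¹ := by
      rw [← h]; group
    rw [hu, this]; group
  have hu2 : u⁻¹ = expGL (H₁ : E →L[ℝ] E) * (n₁ * n₂⁻¹) * (expGL (H₂ : E →L[ℝ] E))⁻¹ := by
    rw [hu1]; group
  have huK : u ∈ 𝔤.K := mul_mem (inv_mem hk₂) hk₁
  have hstar := 𝔤.star_eq_inv_of_mem_K huK
  have h0 : ((H₂ - H₁ : 𝔞) : E →L[ℝ] E) = 0 := by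
    refine eq_zero_of_trace_unitary (u := u) (h𝔞.star_eq (H₂ - H₁).2)
      (by rw [hstar, Units.inv_mul]) ?_ ?_
    · rw [hu1, htr _ _ _ (mul_mem hn₂ (inv_mem hn₁))]
    · rw [hstar, hu2, htr _ _ _ (mul_mem hn₁ (inv_mem hn₂)), ← NegMemClass.coe_neg, neg_sub]
  exact (sub_eq_zero.1 (Subtype.ext h0)).symm

/-- Uniqueness makes the choice in `iwasawaProj` immaterial. -/
theorem iwasawaProj_eq (h𝔞 : 𝔤.IsMaximalCommutative 𝔞) {H₀ H : 𝔞}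
    {k n : (E →L[ℝ] E)ˣ} (hk : k ∈ 𝔤.K) (hn : n ∈ 𝔤.N 𝔞 H₀) :
    𝔤.iwasawaProj 𝔞 H₀ (k * expGL (H : E →L[ℝ] E) * n) = H := by
  have hex : ∃ H' : 𝔞, ∃ k' ∈ 𝔤.K, ∃ n' ∈ 𝔤.N 𝔞 H₀,
      k * expGL (H : E →L[ℝ] E) * n = k' * expGL (H' : E →L[ℝ] E) * n' := ⟨H, k, hk, n, hn, rfl⟩
  rw [iwasawaProj, dif_pos hex]
  obtain ⟨k', hk', n', hn', h⟩ := hex.choose_spec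
  exact iwasawa_unique h𝔞 hk' hk hn' hn h.symm

end ReductiveLieAlgebra

end Roots

end RealReductive

/-- Elements of a sum of three subspaces can be decomposed linearly. -/
theorem Submodule.exists_linear_decomposition {V : Type*} [AddCommGroup V] [Module ℝ V]
    (A B C : Submodule ℝ V) : ∃ (f : V →ₗ[ℝ] A) (g : V →ₗ[ℝ] B),
      ∀ x ∈ A ⊔ (B ⊔ C), x - f x - g x ∈ C := by
  let φ : A × (B × C) →ₗ[ℝ] V := A.subtype.coprod (B.subtype.coprod C.subtype)
  -- The sum need not be direct: any linear section of the addition map, extended to `V`, supplies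
  -- components.
  obtain ⟨g, hg⟩ := φ.rangeRestrict.exists_rightInverse_of_surjective φ.range_rangeRestrict
  obtain ⟨G, hG⟩ := LinearMap.exists_extend g
  refine ⟨LinearMap.fst ℝ A (B × C) ∘ₗ G,
    LinearMap.fst ℝ B C ∘ₗ LinearMap.snd ℝ A (B × C) ∘ₗ G, fun x hx => ?_⟩
  have hxr : x ∈ LinearMap.range φ := by
    simpa [φ, LinearMap.range_coprod] using hx
  have h1 : φ (G x) = x := by
    have h2 := LinearMap.congr_fun hG ⟨x, hxr⟩
    have h3 := congrArg Subtype.val (LinearMap.congr_fun hg ⟨x, hxr⟩)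
    simp only [LinearMap.comp_apply, Submodule.subtype_apply] at h2
    rw [h2]
    exact h3
  have h4 : x - (G x).1 - (G x).2.1 = (G x).2.2 := by
    nth_rw 1 [← h1]
    simp only [φ, LinearMap.coprod_apply, Submodule.subtype_apply]
    abel
  simp only [LinearMap.comp_apply, LinearMap.fst_apply, LinearMap.snd_apply]
  rw [h4]
  exact (G x).2.2.2

theorem HasDerivAt.submodule_coe {F : Type*} [NormedAddCommGroup F] [NormedSpace ℝ F]
    {W : Submodule ℝ F} {H : ℝ → W} {H' : W} {t : ℝ} (h : HasDerivAt H H' t) :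
    HasDerivAt (fun s => (H s : F)) (H' : F) t :=
  (W.subtypeL.hasFDerivAt (x := H t)).comp_hasDerivAt t h

namespace RealReductive

/-! ### The flow in `K` and the local Iwasawa decomposition. -/

section Flow

variable {E : Type*} [NormedAddCommGroup E] [InnerProductSpace ℝ E] [FiniteDimensional ℝ E]
  [CompleteSpace E]

/-- The local flow of `k' = k p(k* Y k)` starting at `1`, with parameter `Y`. -/
theorem exists_flow (p : (E →L[ℝ] E) →L[ℝ] (E →L[ℝ] E)) :
    ∃ r > 0, ∃ ε > 0, ∃ q : (E →L[ℝ] E) × ℝ → (E →L[ℝ] E),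
      ContinuousOn q (Metric.closedBall 0 r ×ˢ Set.Icc (-ε) ε) ∧
      ∀ Y ∈ Metric.closedBall (0 : E →L[ℝ] E) r, q (Y, 0) = 1 ∧ ∀ t ∈ Set.Ioo (-ε) ε,
        HasDerivAt (fun t => q (Y, t)) (q (Y, t) * p (star (q (Y, t)) * Y * q (Y, t))) t := by
  -- The parameter `Y` becomes a second coordinate with zero velocity, so continuity in the initial
  -- value gives joint continuity in `Y` and `t`.
  let F : (E →L[ℝ] E) × (E →L[ℝ] E) → (E →L[ℝ] E) × (E →L[ℝ] E) := fun z =>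
    (z.1 * p (star z.1 * z.2 * z.1), 0)
  have hF : ContDiff ℝ 1 F := by
    have hstar : ContDiff ℝ 1 (fun z : (E →L[ℝ] E) × (E →L[ℝ] E) => star z.1) :=
      (starL' ℝ : (E →L[ℝ] E) ≃L[ℝ] (E →L[ℝ] E)).contDiff.comp contDiff_fst
    exact (contDiff_fst.mul (p.contDiff.comp ((hstar.mul contDiff_snd).mul contDiff_fst))).prodMk
      contDiff_const
  obtain ⟨ε, hε, a, r, L, K, hr, hP⟩ :=
    IsPicardLindelof.of_contDiffAt_one (hF.contDiffAt (x := ((1, 0) : (E →L[ℝ] E) × (E →L[ℝ] E))))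
  obtain ⟨α, hα, hαc⟩ := (hP 0).exists_forall_mem_closedBall_eq_hasDerivWithinAt_continuousOn
  simp only [zero_sub, zero_add] at hα hαc
  have hmem : ∀ Y ∈ Metric.closedBall (0 : E →L[ℝ] E) r,
      ((1, Y) : (E →L[ℝ] E) × (E →L[ℝ] E)) ∈ Metric.closedBall (1, 0) (r : ℝ) := fun Y hY => by
    rw [Metric.mem_closedBall, Prod.dist_eq]
    simpa using hY
  refine ⟨r, hr, ε, hε, fun z => (α ((1, z.1), z.2)).1, ?_, fun Y hY => ?_⟩
  · refine continuous_fst.comp_continuousOn (hαc.comp (by fun_prop) fun z hz => ?_)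
    exact ⟨hmem _ hz.1, hz.2⟩
  obtain ⟨h0, hd⟩ := hα _ (hmem Y hY)
  have hd' : ∀ t ∈ Set.Ioo (-ε) ε,
      HasDerivAt (fun t => α ((1, Y), t)) (F (α ((1, Y), t))) t := fun t ht =>
    (hd t (Set.Ioo_subset_Icc_self ht)).hasDerivAt (Icc_mem_nhds ht.1 ht.2)
  have hY' : ∀ t ∈ Set.Ioo (-ε) ε, (α ((1, Y), t)).2 = Y := by
    intro t ht
    have h2 : ∀ s ∈ Set.Ioo (-ε) ε, HasDerivAt (fun t => (α ((1, Y), t)).2) 0 s := fun s hs =>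
      (hd' s hs).snd
    have := isOpen_Ioo.is_const_of_deriv_eq_zero isPreconnected_Ioo
      (fun s hs => (h2 s hs).differentiableAt.differentiableWithinAt)
      (fun s hs => (h2 s hs).deriv) ht (⟨by linarith, hε⟩ : (0 : ℝ) ∈ Set.Ioo (-ε) ε)
    exact this.trans (by rw [h0])
  refine ⟨by simp only [h0], fun t ht => ?_⟩
  have h1 := (hd' t ht).fst
  simp only [F, hY' t ht] at h1
  exact h1

end Flow

section Iwasawa

variable {E : Type*} [NormedAddCommGroup E] [InnerProductSpace ℝ E] [FiniteDimensional ℝ E]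
  [CompleteSpace E]

namespace ReductiveLieAlgebra

variable {𝔤 : ReductiveLieAlgebra E} {𝔞 : Submodule ℝ (E →L[ℝ] E)}

/-- Compactness of `K` makes its image in the operators closed, as `mem_of_hasDerivAt_of_skew`
requires. Negative times follow by reversing the curve. -/
theorem exists_mem_K_of_hasDerivAt {ε : ℝ} {κ k : ℝ → E →L[ℝ] E}
    (hκ : ∀ t, κ t ∈ skewPart 𝔤.toLieSubalgebra) (hk0 : k 0 = 1)
    (hk : ∀ t ∈ Set.Ioo (-ε) ε, HasDerivAt k (k t * κ t) t) {t : ℝ} (ht : t ∈ Set.Ioo (-ε) ε) :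
    ∃ g ∈ 𝔤.K, (g : E →L[ℝ] E) = k t := by
  set S : Set (E →L[ℝ] E) := Units.val '' (𝔤.K : Set (E →L[ℝ] E)ˣ) with hS
  have hSc : IsClosed S := (𝔤.isCompact_lieSubgroup.image Units.continuous_val).isClosed
  have h1 : (1 : E →L[ℝ] E) ∈ S := ⟨1, one_mem _, rfl⟩
  have hmul : ∀ g ∈ S, ∀ T ∈ skewPart 𝔤.toLieSubalgebra, g * NormedSpace.exp T ∈ S := by
    rintro _ ⟨g, hg, rfl⟩ T hT
    exact ⟨g * expGL T, mul_mem hg (expGL_mem_lieSubgroup hT), rfl⟩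
  rcases le_total 0 t with h | h
  · exact mem_of_hasDerivAt_of_skew hSc h1 (fun T hT => 𝔤.star_eq_of_mem_skewPart hT) hmul hκ hk0
      (b := t) (fun s hs => hk s ⟨by linarith [ht.1, ht.2, hs.1], hs.2.trans_lt ht.2⟩) ⟨h, le_rfl⟩
  · have := mem_of_hasDerivAt_of_skew hSc h1 (fun T hT => 𝔤.star_eq_of_mem_skewPart hT) hmul
      (κ := fun s => -κ (-s)) (k := fun s => k (-s)) (b := -t) (t := -t)
      (fun s => neg_mem (hκ _)) (by simpa using hk0)
      (fun s hs => by
        have h2 : HasDerivAt k (k (-s) * κ (-s)) (-s) :=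
          hk (-s) ⟨by linarith [ht.1, hs.2], by linarith [ht.1, ht.2, hs.1]⟩
        exact (h2.scomp s (hasDerivAt_neg s)).congr_deriv (by simp)) ⟨by linarith, le_rfl⟩
    rw [neg_neg] at this
    exact this

/-- The equation satisfied by `q(t)* exp (tY)` if `q' = q T` with `q` orthogonal and `T` skew. -/
theorem hasDerivAt_star_mul_exp {q : ℝ → E →L[ℝ] E} {T Y : E →L[ℝ] E} {t : ℝ} (hT : star T = -T)
    (hq : HasDerivAt q (q t * T) t) (hu : q t * star (q t) = 1) :
    HasDerivAt (fun t => star (q t) * NormedSpace.exp (t • Y))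
      ((star (q t) * Y * q t - T) * (star (q t) * NormedSpace.exp (t • Y))) t := by
  have h1 : HasDerivAt (fun t => star (q t)) (star (q t * T)) t :=
    (starL' ℝ : (E →L[ℝ] E) ≃L[ℝ] (E →L[ℝ] E)).hasFDerivAt.comp_hasDerivAt t hq
  refine (h1.mul (hasDerivAt_exp_smul_const' (𝕂 := ℝ) Y t)).congr_deriv ?_
  rw [star_mul, hT, sub_mul]
  have h2 : star (q t) * Y * q t * (star (q t) * NormedSpace.exp (t • Y))
      = star (q t) * (Y * NormedSpace.exp (t • Y)) := by
    calc _ = star (q t) * Y * (q t * star (q t)) * NormedSpace.exp (t • Y) := by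
          simp only [mul_assoc]
      _ = _ := by rw [hu, mul_one, mul_assoc]
  rw [h2]
  noncomm_ring

set_option maxHeartbeats 1000000 in
/-- The local Iwasawa decomposition: the Iwasawa projection of `exp (tY)` is the integral of
the `𝔞`-component along a curve in `K`. -/
theorem exists_iwasawaProj_eq_integral (h𝔞 : 𝔤.IsMaximalCommutative 𝔞) {H₀ : 𝔞}
    (hH₀ : 𝔤.IsRegular 𝔞 H₀) :
    ∃ P : (E →L[ℝ] E) →L[ℝ] 𝔞,
      (∀ Y ∈ 𝔤.𝔰, ∀ H ∈ 𝔞, traceForm H (P Y : E →L[ℝ] E) = traceForm H Y) ∧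
      ∃ r > 0, ∃ ε > 0, ∃ q : (E →L[ℝ] E) × ℝ → (E →L[ℝ] E),
      ContinuousOn q (Metric.closedBall 0 r ×ˢ Set.Icc (-ε) ε) ∧
      ∀ Y ∈ 𝔤.𝔰, Y ∈ Metric.closedBall (0 : E →L[ℝ] E) r → q (Y, 0) = 1 ∧
        ∀ t ∈ Set.Ioo (-ε) ε, q (Y, t) ∈ unitary (E →L[ℝ] E) ∧ ∀ k ∈ 𝔤.K,
          𝔤.iwasawaProj 𝔞 H₀ (k * expGL (t • Y))
            = ∫ s in (0 : ℝ)..t, P (star (q (Y, s)) * Y * q (Y, s)) := by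
  obtain ⟨f, g, hfg⟩ := Submodule.exists_linear_decomposition
    (skewPart 𝔤.toLieSubalgebra) 𝔞 (𝔤.nilpotentPart 𝔞 H₀)
  let P : (E →L[ℝ] E) →L[ℝ] 𝔞 := LinearMap.toContinuousLinearMap g
  let p : (E →L[ℝ] E) →L[ℝ] (E →L[ℝ] E) :=
    LinearMap.toContinuousLinearMap ((skewPart 𝔤.toLieSubalgebra).subtype ∘ₗ f)
  have hp : ∀ X, p X ∈ skewPart 𝔤.toLieSubalgebra := fun X => (f X).2
  have hpP : ∀ X ∈ 𝔤.toLieSubalgebra, X - p X - P X ∈ 𝔤.nilpotentPart 𝔞 H₀ := fun X hX =>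
    hfg X (mem_skewPart_sup_sup h𝔞 hH₀ hX)
  refine ⟨P, fun Y hY H hH => ?_, ?_⟩
  -- `Y - P Y` is the sum of a skew element and one of `𝔫`, both orthogonal to `𝔞`.
  · have h1 := traceForm_eq_zero_of_mem_nilpotentPart h𝔞 hH (hpP Y hY.1)
    rw [map_sub, map_sub, traceForm_eq_zero_of_symm_of_skew (h𝔞.star_eq hH)
      (𝔤.star_eq_of_mem_skewPart (hp Y))] at h1
    linarith
  obtain ⟨r, hr, ε, hε, q, hqc, hq⟩ := exists_flow p
  refine ⟨r, hr, ε, hε, q, hqc, fun Y hY𝔰 hYr => ?_⟩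
  obtain ⟨hq0, hqd⟩ := hq Y hYr
  have hK : ∀ t ∈ Set.Ioo (-ε) ε, ∃ g ∈ 𝔤.K, (g : E →L[ℝ] E) = q (Y, t) := fun t ht =>
    exists_mem_K_of_hasDerivAt (κ := fun t => p (star (q (Y, t)) * Y * q (Y, t)))
      (k := fun t => q (Y, t)) (fun t => hp _) hq0 hqd ht
  have hu : ∀ t ∈ Set.Ioo (-ε) ε, star (q (Y, t)) * q (Y, t) = 1 ∧
      q (Y, t) * star (q (Y, t)) = 1 := fun t ht => by
    obtain ⟨g, hg, hgq⟩ := hK t ht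
    rw [← hgq, 𝔤.star_eq_inv_of_mem_K hg]
    simp
  refine ⟨hq0, fun t ht => ⟨Unitary.mem_iff.2 (hu t ht), ?_⟩⟩
  have h0 : (0 : ℝ) ∈ Set.Ioo (-ε) ε := ⟨by linarith, hε⟩
  set y : ℝ → E →L[ℝ] E := fun t => star (q (Y, t)) * Y * q (Y, t) with hy
  have hy𝔰 : ∀ t ∈ Set.Ioo (-ε) ε, y t ∈ 𝔤.𝔰 := fun t ht => by
    obtain ⟨g, hg, hgq⟩ := hK t ht
    rw [hy]
    simp only [← hgq]
    exact 𝔤.star_conj_mem_symmPart hg hY𝔰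
  have hqcY : ContinuousOn (fun t => q (Y, t)) (Set.Ioo (-ε) ε) := fun t ht =>
    (hqd t ht).continuousAt.continuousWithinAt
  have hyc : ContinuousOn y (Set.Ioo (-ε) ε) :=
    (hqcY.star.mul continuousOn_const).mul hqcY
  have hPy : ContinuousOn (fun t => P (y t)) (Set.Ioo (-ε) ε) := P.continuous.comp_continuousOn hyc
  set H : ℝ → 𝔞 := fun t => ∫ s in (0 : ℝ)..t, P (y s) with hH
  have hHd : ∀ t ∈ Set.Ioo (-ε) ε,
      HasDerivAt (fun t => (H t : E →L[ℝ] E)) (P (y t)) t := fun t ht => by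
    have h : HasDerivAt H (P (y t)) t := exists_primitive hPy ht
    exact h.submodule_coe
  have hHc : ContinuousOn (fun t => (H t : E →L[ℝ] E)) (Set.Ioo (-ε) ε) := fun t ht =>
    (hHd t ht).continuousAt.continuousWithinAt
  have hbd : ∀ t ∈ Set.Ioo (-ε) ε, HasDerivAt (fun t => star (q (Y, t)) * NormedSpace.exp (t • Y))
      ((y t - p (y t)) * (star (q (Y, t)) * NormedSpace.exp (t • Y))) t := fun t ht =>
    hasDerivAt_star_mul_exp (𝔤.star_eq_of_mem_skewPart (hp (y t))) (hqd t ht) (hu t ht).2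
  -- Splitting `exp(H)` off `q* exp(tY)` removes the `𝔞`-component of the coefficient; the rest
  -- stays in `𝔫` because `𝔞` normalizes `𝔫`.
  obtain ⟨n, hn, hnp⟩ := exists_mem_lieSubgroup_of_hasDerivAt
    (fun 𝔪 h𝔪 h => eq_bot_of_le_span_lie h𝔪 h) (𝔤.nilpotentPart 𝔞 H₀) le_rfl
    (fun X hX Y hY => lie_mem_nilpotentPart hX hY)
    (ν := fun t => NormedSpace.exp (-(H t : E →L[ℝ] E)) * ((y t - p (y t)) - P (y t))
      * NormedSpace.exp (H t : E →L[ℝ] E))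
    (p := fun t => NormedSpace.exp (-(H t : E →L[ℝ] E))
      * (star (q (Y, t)) * NormedSpace.exp (t • Y)))
    (((continuous_exp'.comp_continuousOn hHc.neg).mul
      ((hyc.sub (p.continuous.comp_continuousOn hyc)).sub
        (continuous_subtype_val.comp_continuousOn hPy))).mul
      (continuous_exp'.comp_continuousOn hHc))
    (fun t ht => by
      have := exp_conj_mem (isClosed_submodule (𝔤.nilpotentPart 𝔞 H₀))
        (T := -(H t : E →L[ℝ] E))
        (fun X hX => lie_mem_nilpotentPart_of_mem (𝔞.neg_mem (H t).2) hX)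
        (hpP (y t) (hy𝔰 t ht).1)
      rwa [neg_neg] at this)
    (by simp [hH, hq0])
    (fun t ht => hasDerivAt_exp_neg_mul (hHd t ht) (fun s => h𝔞.commute (H t).2 (H s).2)
      (hbd t ht)) ht
  intro k hk
  obtain ⟨g, hg, hgq⟩ := hK t ht
  have hdec : k * expGL (t • Y) = (k * g) * expGL (H t : E →L[ℝ] E) * n := by
    rw [mul_assoc, mul_assoc]
    congr 1
    ext1
    rw [Units.val_mul, Units.val_mul, hnp, hgq]
    change NormedSpace.exp (t • Y) = _ * (NormedSpace.exp (H t : E →L[ℝ] E) * _)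
    rw [← mul_assoc (NormedSpace.exp (H t : E →L[ℝ] E)), exp_mul_exp_neg', one_mul, ← mul_assoc,
      (hu t ht).2, one_mul]
  rw [hdec, iwasawaProj_eq h𝔞 (mul_mem hk hg) hn]

end ReductiveLieAlgebra

end Iwasawa

end RealReductive

/-- Haar measure on a compact group is invariant under inversion. -/
theorem MeasureTheory.Measure.IsHaarMeasure.isInvInvariant_of_compactSpace {G : Type*} [Group G]
    [TopologicalSpace G] [IsTopologicalGroup G] [CompactSpace G] [MeasurableSpace G]
    [BorelSpace G] (μ : Measure G) [μ.IsHaarMeasure] : μ.IsInvInvariant := by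
  -- Conjugations are continuous surjective endomorphisms of a compact group and preserve Haar
  -- measure, so left invariance gives right invariance.
  have hr : μ.IsMulRightInvariant := ⟨fun g => by
    have h1 : MeasurePreserving (MulAut.conj g⁻¹).toMonoidHom μ μ :=
      MonoidHom.measurePreserving (by
        change Continuous fun x => g⁻¹ * x * g⁻¹⁻¹
        fun_prop) (MulAut.conj g⁻¹).surjective rfl
    have h2 := (measurePreserving_mul_left μ g).comp h1
    have h3 : (fun x => x * g) = (fun x => g * x) ∘ (MulAut.conj g⁻¹).toMonoidHom := by
      ext x
      simp [mul_assoc]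
    rw [h3]
    exact h2.map_eq⟩
  have hf : IsFiniteMeasure μ.inv := by rw [Measure.inv_def]; infer_instance
  refine ⟨?_⟩
  -- `μ.inv` is now left invariant, hence a multiple of `μ`; equal total masses make the factor `1`.
  have h := Measure.isMulInvariant_eq_smul_of_compactSpace μ.inv μ
  have h1 := congrArg (fun ν : Measure G => ν Set.univ) h
  simp only [Measure.smul_apply, Measure.inv_apply, Set.inv_univ] at h1
  have hc : Measure.haarScalarFactor μ.inv μ = 1 := by
    rw [ENNReal.smul_def, smul_eq_mul] at h1
    have h2 : (1 : ENNReal) * μ Set.univ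
        = (Measure.haarScalarFactor μ.inv μ : ENNReal) * μ Set.univ := by
      rw [one_mul]; exact h1
    rw [ENNReal.mul_left_inj (NeZero.ne _) (measure_ne_top _ _)] at h2
    exact_mod_cast h2.symm
  rw [h, hc, one_smul]

namespace RealReductive

/-! ### The pairing, integration over `K`, and the rescaled Iwasawa projection. -/

section Limit

variable {E : Type*} [NormedAddCommGroup E] [InnerProductSpace ℝ E] [FiniteDimensional ℝ E]
  [CompleteSpace E]

namespace ReductiveLieAlgebra

variable {𝔤 : ReductiveLieAlgebra E} {𝔞 : Submodule ℝ (E →L[ℝ] E)}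

theorem pairing_smul_left (c : ℂ) (lam : ℂ ⊗[ℝ] 𝔞) (Y : E →L[ℝ] E) :
    pairing 𝔞 (c • lam) Y = c * pairing 𝔞 lam Y := by
  rw [pairing, map_smul, smul_eq_mul, pairing]

theorem pairing_add_right (lam : ℂ ⊗[ℝ] 𝔞) (Y Z : E →L[ℝ] E) :
    pairing 𝔞 lam (Y + Z) = pairing 𝔞 lam Y + pairing 𝔞 lam Z := by
  induction lam using TensorProduct.induction_on with
  | zero => simp [pairing]
  | tmul c H => simp [pairing, mul_add]
  | add x y hx hy =>
    simp only [pairing, map_add] at hx hy ⊢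
    rw [hx, hy]
    ring

theorem pairing_smul_right (lam : ℂ ⊗[ℝ] 𝔞) (c : ℝ) (Y : E →L[ℝ] E) :
    pairing 𝔞 lam (c • Y) = c • pairing 𝔞 lam Y := by
  induction lam using TensorProduct.induction_on with
  | zero => simp [pairing]
  | tmul d H => simp [pairing, mul_left_comm]
  | add x y hx hy =>
    simp only [pairing, map_add] at hx hy ⊢
    rw [hx, hy, smul_add]

theorem pairing_congr (lam : ℂ ⊗[ℝ] 𝔞) {Y Z : E →L[ℝ] E}
    (h : ∀ H ∈ 𝔞, traceForm H Y = traceForm H Z) : pairing 𝔞 lam Y = pairing 𝔞 lam Z := by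
  have : traceForm.flip Y ∘ₗ 𝔞.subtype = traceForm.flip Z ∘ₗ 𝔞.subtype := by
    ext H
    exact h H H.2
  rw [pairing, pairing, this]

/-- The pairing with a fixed `lam` as a continuous linear form. -/
theorem exists_pairing_eq (lam : ℂ ⊗[ℝ] 𝔞) :
    ∃ Λ : (E →L[ℝ] E) →L[ℝ] ℂ, ∀ Y, Λ Y = pairing 𝔞 lam Y :=
  ⟨LinearMap.toContinuousLinearMap
    { toFun := pairing 𝔞 lam
      map_add' := pairing_add_right lam
      map_smul' := fun c Y => by simpa using pairing_smul_right lam c Y }, fun _ => rfl⟩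

instance : 𝔤.haarK.IsHaarMeasure := by unfold haarK; infer_instance

instance : IsProbabilityMeasure 𝔤.haarK := ⟨by
  rw [haarK]; exact Measure.haarMeasure_self⟩

/-- The limit produces `k*Xk` where the plane wave has `kXk*`; the substitution `k ↦ k⁻¹ = k*`
exchanges them. -/
theorem integral_star_mul_mul (X : E →L[ℝ] E) (f : (E →L[ℝ] E) → ℂ) :
    ∫ k : 𝔤.K, f (star ((k : (E →L[ℝ] E)ˣ) : E →L[ℝ] E) * X * ((k : (E →L[ℝ] E)ˣ) : E →L[ℝ] E))
        ∂𝔤.haarK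
      = ∫ k : 𝔤.K, f (((k : (E →L[ℝ] E)ˣ) : E →L[ℝ] E) * X
        * star ((k : (E →L[ℝ] E)ˣ) : E →L[ℝ] E)) ∂𝔤.haarK := by
  have := Measure.IsHaarMeasure.isInvInvariant_of_compactSpace 𝔤.haarK
  rw [← integral_inv_eq_self _ 𝔤.haarK]
  refine integral_congr_ae (Eventually.of_forall fun k => ?_)
  have h1 := 𝔤.star_eq_inv_of_mem_K k.2
  have h2 := 𝔤.star_eq_inv_of_mem_K (k⁻¹).2
  simp only [Subgroup.coe_inv, inv_inv] at h2
  simp only [Subgroup.coe_inv, h1, h2]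

/-- The local behaviour of the Iwasawa projection along `exp (X / n) k`. -/
theorem exists_iwasawaProj_tendsto (h𝔞 : 𝔤.IsMaximalCommutative 𝔞) {H₀ : 𝔞}
    (hH₀ : 𝔤.IsRegular 𝔞 H₀) (X : 𝔤.𝔰) :
    ∃ P : (E →L[ℝ] E) →L[ℝ] 𝔞,
      (∀ Y ∈ 𝔤.𝔰, ∀ H ∈ 𝔞, traceForm H (P Y : E →L[ℝ] E) = traceForm H Y) ∧
      (∃ C : ℝ, ∀ᶠ n : ℕ in atTop, ∀ k : 𝔤.K, ‖(n : ℝ) • (𝔤.iwasawaProj 𝔞 H₀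
        ((𝔤.expG ((n : ℝ)⁻¹ • X) : (E →L[ℝ] E)ˣ) * (k : (E →L[ℝ] E)ˣ)) : E →L[ℝ] E)‖ ≤ C) ∧
      (∀ᶠ n : ℕ in atTop, Continuous fun k : 𝔤.K => 𝔤.iwasawaProj 𝔞 H₀
        ((𝔤.expG ((n : ℝ)⁻¹ • X) : (E →L[ℝ] E)ˣ) * (k : (E →L[ℝ] E)ˣ))) ∧
      ∀ k : 𝔤.K, Tendsto (fun n : ℕ => (n : ℝ) • 𝔤.iwasawaProj 𝔞 H₀
        ((𝔤.expG ((n : ℝ)⁻¹ • X) : (E →L[ℝ] E)ˣ) * (k : (E →L[ℝ] E)ˣ))) atTop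
        (𝓝 (P (star ((k : (E →L[ℝ] E)ˣ) : E →L[ℝ] E) * (X : E →L[ℝ] E)
          * ((k : (E →L[ℝ] E)ˣ) : E →L[ℝ] E)))) := by
  obtain ⟨P, hP, r, hr, ε, hε, q, hqc, hq⟩ := exists_iwasawaProj_eq_integral h𝔞 hH₀
  refine ⟨P, hP, ?_⟩
  set Z : 𝔤.K → E →L[ℝ] E := fun k => star ((k : (E →L[ℝ] E)ˣ) : E →L[ℝ] E) * (X : E →L[ℝ] E)
    * ((k : (E →L[ℝ] E)ˣ) : E →L[ℝ] E) with hZ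
  have hval : Continuous fun k : 𝔤.K => ((k : (E →L[ℝ] E)ˣ) : E →L[ℝ] E) :=
    Units.continuous_val.comp continuous_subtype_val
  have hZc : Continuous Z := (hval.star.mul continuous_const).mul hval
  -- Dividing `k*Xk` by `M` brings it into the ball of radius `r` where the flow exists, so `X/n`
  -- corresponds to time `M/n`. The summand `1` keeps `M` positive when `X = 0`.
  set M : ℝ := ‖(X : E →L[ℝ] E)‖ / r + 1 with hM
  have hM0 : 0 < M := by positivity
  set Y : 𝔤.K → E →L[ℝ] E := fun k => M⁻¹ • Z k with hY
  have hYc : Continuous Y := (continuous_const_smul M⁻¹).comp hZc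
  have hZ𝔰 : ∀ k, Z k ∈ 𝔤.𝔰 := fun k => 𝔤.star_conj_mem_symmPart k.2 X.2
  have hY𝔰 : ∀ k, Y k ∈ 𝔤.𝔰 := fun k => Submodule.smul_mem _ _ (hZ𝔰 k)
  have hconj : ∀ (u : unitary (E →L[ℝ] E)) (W : E →L[ℝ] E),
      ‖star (u : E →L[ℝ] E) * W * (u : E →L[ℝ] E)‖ = ‖W‖ := fun u W => by
    rw [CStarRing.norm_mul_coe_unitary, CStarRing.norm_mem_unitary_mul _ (Unitary.star_mem u.2)]
  have hKu : ∀ k : 𝔤.K, ((k : (E →L[ℝ] E)ˣ) : E →L[ℝ] E) ∈ unitary (E →L[ℝ] E) := fun k => by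
    rw [Unitary.mem_iff, 𝔤.star_eq_inv_of_mem_K k.2]
    simp
  have hYr : ∀ k, ‖Y k‖ ≤ r := fun k => by
    have h1 : ‖Z k‖ = ‖(X : E →L[ℝ] E)‖ := hconj ⟨_, hKu k⟩ _
    rw [hY]
    simp only [norm_smul, norm_inv, Real.norm_eq_abs, abs_of_pos hM0, h1]
    rw [inv_mul_le_iff₀ hM0, hM, add_mul, div_mul_cancel₀ _ hr.ne']
    linarith
  have hYb : ∀ k, Y k ∈ Metric.closedBall (0 : E →L[ℝ] E) r := fun k => by simpa using hYr k
  set G : 𝔤.K → ℝ → 𝔞 := fun k s => P (star (q (Y k, s)) * Y k * q (Y k, s)) with hG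
  have hA : ∀ n : ℕ, 0 < n → M / n < ε → ∀ k : 𝔤.K, 𝔤.iwasawaProj 𝔞 H₀
      ((𝔤.expG ((n : ℝ)⁻¹ • X) : (E →L[ℝ] E)ˣ) * (k : (E →L[ℝ] E)ˣ))
        = ∫ s in (0 : ℝ)..(M / n), G k s := by
    intro n hn hnε k
    have hn' : (0 : ℝ) < n := Nat.cast_pos.2 hn
    have h1 := ((hq (Y k) (hY𝔰 k) (hYb k)).2 (M / n)
      ⟨by linarith [div_pos hM0 hn'], hnε⟩).2 k k.2
    rw [← h1]
    congr 1
    ext1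
    have h2 : (M / n) • Y k = ((k : (E →L[ℝ] E)ˣ)⁻¹ : (E →L[ℝ] E)ˣ)
        * ((n : ℝ)⁻¹ • (X : E →L[ℝ] E)) * ((k : (E →L[ℝ] E)ˣ) : E →L[ℝ] E) := by
      rw [← 𝔤.star_eq_inv_of_mem_K k.2, hY]
      simp only [hZ, smul_smul, mul_smul_comm, smul_mul_assoc]
      congr 1
      field_simp
    change NormedSpace.exp ((n : ℝ)⁻¹ • (X : E →L[ℝ] E)) * _ = _ * NormedSpace.exp ((M / n) • Y k)
    let _ : NormedAlgebra ℚ (E →L[ℝ] E) := NormedAlgebra.restrictScalars ℚ ℝ (E →L[ℝ] E)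
    rw [h2, NormedSpace.exp_units_conj', ← mul_assoc, ← mul_assoc, Units.mul_inv, one_mul]
  have hev : ∀ᶠ n : ℕ in atTop, 0 < n ∧ M / n < ε :=
    (eventually_gt_atTop 0).and
      ((tendsto_const_div_atTop_nhds_zero_nat M).eventually (gt_mem_nhds hε))
  set P' : (E →L[ℝ] E) →L[ℝ] (E →L[ℝ] E) := 𝔞.subtypeL.comp P with hP'
  have hGb : ∀ k, ∀ s ∈ Set.Ioo (-ε) ε, ‖G k s‖ ≤ ‖P'‖ * r := fun k s hs => by
    refine (P'.le_opNorm _).trans (mul_le_mul_of_nonneg_left ?_ (norm_nonneg _))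
    rw [hconj ⟨_, ((hq (Y k) (hY𝔰 k) (hYb k)).2 s hs).1⟩]
    exact hYr k
  refine ⟨⟨‖P'‖ * r * M, ?_⟩, ?_, fun k => ?_⟩
  · filter_upwards [hev] with n hn k
    have hn' : (0 : ℝ) < n := Nat.cast_pos.2 hn.1
    have hMn : 0 < M / n := div_pos hM0 hn'
    rw [hA n hn.1 hn.2 k, norm_smul, Real.norm_eq_abs, abs_of_pos hn']
    have h1 := intervalIntegral.norm_integral_le_of_norm_le_const (a := 0) (b := M / n)
      (f := G k) (C := ‖P'‖ * r) (fun s hs => by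
        rw [Set.uIoc_of_le hMn.le] at hs
        exact hGb k s ⟨by linarith [hs.1], hs.2.trans_lt hn.2⟩)
    rw [sub_zero, abs_of_pos hMn] at h1
    rw [Submodule.coe_norm] at h1
    calc (n : ℝ) * _ ≤ n * (‖P'‖ * r * (M / n)) := by gcongr
      _ = _ := by field_simp
  · filter_upwards [hev] with n hn
    have hn' : (0 : ℝ) < n := Nat.cast_pos.2 hn.1
    have hMn : 0 < M / n := div_pos hM0 hn'
    have hεε : -ε ≤ ε := by linarith
    -- Since `q` is controlled only for times in `[-ε, ε]`, time is clamped to that interval to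
    -- obtain a globally continuous integrand.
    have h1 : Continuous fun z : 𝔤.K × ℝ => q (Y z.1, (Set.projIcc (-ε) ε hεε z.2 : ℝ)) :=
      hqc.comp_continuous ((hYc.comp continuous_fst).prodMk
        (continuous_subtype_val.comp (continuous_projIcc.comp continuous_snd)))
        fun z => ⟨hYb _, (Set.projIcc (-ε) ε hεε z.2).2⟩
    have h2 : Continuous (Function.uncurry fun (k : 𝔤.K) (s : ℝ) =>
        G k (Set.projIcc (-ε) ε hεε s : ℝ)) :=
      P.continuous.comp ((h1.star.mul (hYc.comp continuous_fst)).mul h1)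
    have h3 := intervalIntegral.continuous_parametric_intervalIntegral_of_continuous' (μ := volume)
      h2 0 (M / n)
    refine h3.congr fun k => ?_
    rw [hA n hn.1 hn.2 k]
    refine intervalIntegral.integral_congr fun s hs => ?_
    rw [Set.uIcc_of_le hMn.le] at hs
    rw [Set.projIcc_of_mem hεε ⟨by linarith [hs.1], hs.2.trans hn.2.le⟩]
  · have hq0 := (hq (Y k) (hY𝔰 k) (hYb k)).1
    have h0 : (0 : ℝ) ∈ Set.Ioo (-ε) ε := ⟨by linarith, hε⟩
    have hqk : ContinuousOn (fun s => q (Y k, s)) (Set.Ioo (-ε) ε) :=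
      hqc.comp (by fun_prop) fun s hs => ⟨hYb k, Set.Ioo_subset_Icc_self hs⟩
    have hGc : ContinuousOn (G k) (Set.Ioo (-ε) ε) :=
      P.continuous.comp_continuousOn ((hqk.star.mul continuousOn_const).mul hqk)
    have hd := exists_primitive hGc h0
    have hG0 : G k 0 = P (Y k) := by simp [hG, hq0]
    rw [hG0] at hd
    -- The limit is `M` times the derivative at `0` of the integral, sampled at times `M/n`.
    have h1 := hd.tendsto_slope_zero
    simp only [zero_add, intervalIntegral.integral_same, sub_zero] at h1
    have h2 : Tendsto (fun n : ℕ => M / (n : ℝ)) atTop (𝓝[≠] 0) := by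
      refine tendsto_nhdsWithin_iff.2 ⟨tendsto_const_div_atTop_nhds_zero_nat M, ?_⟩
      filter_upwards [eventually_gt_atTop 0] with n hn
      have hn' : (0 : ℝ) < n := Nat.cast_pos.2 hn
      exact (div_pos hM0 hn').ne'
    have h3 := (h1.comp h2).const_smul M
    have h4 : M • P (Y k) = P (Z k) := by
      rw [← map_smul, hY]
      simp [smul_smul, hM0.ne']
    rw [h4] at h3
    refine h3.congr' ?_
    filter_upwards [hev] with n hn
    have hn' : (0 : ℝ) < n := Nat.cast_pos.2 hn.1
    rw [hA n hn.1 hn.2 k]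
    simp only [Function.comp, smul_smul]
    congr 1
    field_simp

end ReductiveLieAlgebra

end Limit

end RealReductive

/-! ### Dominated convergence for the spherical functions. -/

theorem mainTheorem3 {E : Type*} [NormedAddCommGroup E] [InnerProductSpace ℝ E]
    [FiniteDimensional ℝ E] [CompleteSpace E]
    (𝔤 : RealReductive.ReductiveLieAlgebra E)
    (𝔞 : Submodule ℝ (E →L[ℝ] E)) (h𝔞 : 𝔤.IsMaximalCommutative 𝔞)
    (H₀ : 𝔞) (hH₀ : 𝔤.IsRegular 𝔞 H₀)
    (lam : ℂ ⊗[ℝ] 𝔞) (X : 𝔤.𝔰) :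
    Tendsto (fun n : ℕ => 𝔤.sphericalFunction 𝔞 H₀ ((n : ℂ) • lam) (𝔤.expG ((n : ℝ)⁻¹ • X)))
      atTop (𝓝 (𝔤.planeWave 𝔞 lam X)) := by
  open RealReductive ReductiveLieAlgebra in
  obtain ⟨P, hP, ⟨C, hC⟩, hcont, hlim⟩ := exists_iwasawaProj_tendsto h𝔞 hH₀ X
  obtain ⟨Λ, hΛ⟩ := exists_pairing_eq lam
  obtain ⟨ρ', hρ'⟩ := LinearMap.exists_extend (𝔤.rho 𝔞 H₀)
  let ρ : (E →L[ℝ] E) →L[ℝ] ℝ := LinearMap.toContinuousLinearMap ρ'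
  have hρ : ∀ H : 𝔞, 𝔤.rho 𝔞 H₀ H = ρ H := fun H => (LinearMap.congr_fun hρ' H).symm
  have hsmul : ∀ (n : ℕ) (H : 𝔞), pairing 𝔞 ((n : ℂ) • lam) H
      = Λ (((n : ℝ) • H : 𝔞) : E →L[ℝ] E) := fun n H => by
    rw [pairing_smul_left, ← hΛ, Submodule.coe_smul, map_smul, Complex.real_smul,
      Complex.ofReal_natCast]
  rw [planeWave, ← integral_star_mul_mul _ fun W => Complex.exp (pairing 𝔞 lam W)]
  unfold sphericalFunction
  simp only [hsmul, hρ, ← hΛ]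
  -- `C` bounds `n` times the projection, hence the `λ`-part of the exponent. For `n ≥ 1` it also
  -- bounds the projection itself, hence the `ρ`-part.
  refine tendsto_integral_filter_of_dominated_convergence
    (fun _ => Real.exp (‖Λ‖ * C + ‖ρ‖ * C)) ?_ ?_ (integrable_const _) ?_
  · filter_upwards [hcont] with n hn
    refine (Complex.continuous_exp.comp (Continuous.sub ?_ ?_)).aestronglyMeasurable
    · exact Λ.continuous.comp ((continuous_const_smul (n : ℝ)).comp (continuous_subtype_val.comp hn))
    · exact Complex.continuous_ofReal.comp (ρ.continuous.comp (continuous_subtype_val.comp hn))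
  · filter_upwards [hC, eventually_ge_atTop 1] with n hn hn1
    refine Eventually.of_forall fun k => ?_
    specialize hn k
    set H := 𝔤.iwasawaProj 𝔞 H₀
        ((𝔤.expG ((n : ℝ)⁻¹ • X) : (E →L[ℝ] E)ˣ) * (k : (E →L[ℝ] E)ˣ))
    have hH : ‖(H : E →L[ℝ] E)‖ ≤ C := by
      refine le_trans ?_ hn
      rw [norm_smul, Real.norm_natCast]
      exact le_mul_of_one_le_left (norm_nonneg _) (by exact_mod_cast hn1)
    refine (Complex.norm_exp_le_exp_norm _).trans (Real.exp_le_exp.2 ?_)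
    refine (norm_sub_le _ _).trans (add_le_add ?_ ?_)
    · exact (Λ.le_opNorm _).trans (mul_le_mul_of_nonneg_left hn (norm_nonneg _))
    · rw [Complex.norm_real]
      exact (ρ.le_opNorm _).trans (mul_le_mul_of_nonneg_left hH (norm_nonneg _))
  · refine Eventually.of_forall fun k => ?_
    have h1 := hlim k
    have hZ := 𝔤.star_conj_mem_symmPart k.2 X.2
    -- The projection is `n⁻¹` times a convergent sequence, so the `ρ`-part, which is not scaled by
    -- `n`, disappears.
    have h2 : Tendsto (fun n : ℕ => 𝔤.iwasawaProj 𝔞 H₀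
        ((𝔤.expG ((n : ℝ)⁻¹ • X) : (E →L[ℝ] E)ˣ) * (k : (E →L[ℝ] E)ˣ))) atTop (𝓝 0) := by
      have h3 := (tendsto_inv_atTop_zero.comp (tendsto_natCast_atTop_atTop (R := ℝ))).smul h1
      rw [zero_smul] at h3
      refine h3.congr' ?_
      filter_upwards [eventually_gt_atTop 0] with n hn
      have hn' : (n : ℝ) ≠ 0 := Nat.cast_ne_zero.2 hn.ne'
      simp [smul_smul, hn']
    rw [hΛ, ← pairing_congr lam (hP _ hZ), ← hΛ]
    refine (Complex.continuous_exp.tendsto _).comp ?_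
    have h4 := ((Λ.continuous.comp continuous_subtype_val).tendsto _).comp h1
    have h5 := ((Complex.continuous_ofReal.comp (ρ.continuous.comp continuous_subtype_val)).tendsto _).comp h2
    simpa using h4.sub h5
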